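/- Let $\alpha \ge 0$, $0 \le \beta < \tfrac32 + \alpha$, $0 \le \nu < 3$ and $\nu \le 2\beta$. For $b > 0$ let $H_b$ be the self-adjoint operator in the complex Hilbert space $L^2(b,b+1)$ associated with the closed quadratic form $$h_b[u] = \int_b^{b+1} \left| \left( \frac{1}{x^{\alpha}} \left( \frac{u(x)}{x^{\beta}} \right)' \right)' \right|^2 x^{2(\alpha+\beta)} \, dx$$ with form domain the Sobolev space $H^2(b,b+1)$ (no boundary conditions imposed). For a bounded real function $V$ on $(b,b+1)$ let $H_b - V$ be the operator sum, with the domain of $H_b$. Then there are constants $D_\nu, E_\nu > 0$, depending only on $\alpha$, $\beta$ and $\nu$, such that for every $b > 0$ and every bounded measurable $V \ge 0$ on $(b,b+1)$ that is not almost everywhere zero and satisfies $$\int_b^{b+1} V(x)\, x^{\nu} \, dx \le D_\nu ,$$ the negative spectrum of $H_b - V$ consists of exactly two eigenvalues, counted with multiplicity, $-E_1$ and $-E_2$, and they satisfy $0 < E_1 \le E_\nu$ and $0 < E_2 \le E_\nu$. -/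

import Mathlib

open MeasureTheory Set
open scoped ENNReal ContDiff ComplexConjugate

noncomputable section

namespace IntervalOp

/-- Lebesgue measure on the interval `(b, b + 1)`. -/
abbrev μ (b : ℝ) : Measure ℝ := volume.restrict (Ioo b (b + 1))

/-- The complex Hilbert space `L²(b, b + 1)`. -/
abbrev L2 (b : ℝ) : Type := Lp ℂ 2 (μ b)

/-! ### Multiplication operators -/

/-- Multiplication by an essentially bounded real function, as an operator on `L²(b, b + 1)`. -/
def mulOp {b : ℝ} (m : ℝ → ℝ) (hm : MemLp m ∞ (μ b)) : L2 b →ₗ[ℂ] L2 b where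
  toFun u := (hm.toLp m • u : L2 b)
  map_add' u v := Lp.add_smul _ u v
  map_smul' c u := by
    simp only [Lp.smul_def, ← MemLp.toLp_const_smul, RingHom.id_apply]
    apply MemLp.toLp_congr
    filter_upwards [Lp.coeFn_smul c u] with x hx
    simp only [Pi.smul_apply', hx, Pi.smul_apply]
    exact smul_comm _ _ _

theorem coeFn_mulOp {b : ℝ} (m : ℝ → ℝ) (hm : MemLp m ∞ (μ b)) (u : L2 b) :
    mulOp m hm u =ᵐ[μ b] fun x => (m x : ℂ) * u x := by
  filter_upwards [Lp.coeFn_lpSMul (r := 2) (hm.toLp m) u, hm.coeFn_toLp] with x h1 h2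
  change (hm.toLp m • u : L2 b) x = _
  rw [h1, Pi.smul_apply', h2, Complex.real_smul]

theorem memLp_rpow {b : ℝ} (hb : 0 < b) (s : ℝ) : MemLp (fun x : ℝ => x ^ s) ∞ (μ b) := by
  have hc : ContinuousOn (fun x : ℝ => x ^ s) (Icc b (b + 1)) := fun x hx =>
    (Real.continuousAt_rpow_const x s (Or.inl (hb.trans_le hx.1).ne')).continuousWithinAt
  obtain ⟨C, hC⟩ := isCompact_Icc.exists_bound_of_continuousOn hc
  refine memLp_top_of_bound
    ((hc.mono Ioo_subset_Icc_self).aestronglyMeasurable measurableSet_Ioo) C ?_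
  filter_upwards [ae_restrict_mem measurableSet_Ioo] with x hx
  exact hC x (Ioo_subset_Icc_self hx)

/-- Multiplication by `x ^ s` on `L²(b, b + 1)`, `b > 0`. -/
def powOp {b : ℝ} (hb : 0 < b) (s : ℝ) : L2 b →ₗ[ℂ] L2 b :=
  mulOp (fun x => x ^ s) (memLp_rpow hb s)

/-! ### Weak derivatives and the Sobolev space `H²(b, b + 1)` -/

/-- `φ` is a (real) test function on `(b, b + 1)`, that is, `φ ∈ C_c^∞(b, b + 1)`. -/
structure IsTest (b : ℝ) (φ : ℝ → ℝ) : Prop where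
  smooth : ContDiff ℝ ∞ φ
  compact : HasCompactSupport φ
  supp : tsupport φ ⊆ Ioo b (b + 1)

/-- `g` is the weak derivative of `f` on `(b, b + 1)`. -/
def HasWeakDeriv {b : ℝ} (f g : L2 b) : Prop :=
  ∀ φ : ℝ → ℝ, IsTest b φ →
    ∫ x in Ioo b (b + 1), ((deriv φ x : ℝ) : ℂ) * f x =
      -∫ x in Ioo b (b + 1), ((φ x : ℝ) : ℂ) * g x

theorem IsTest.deriv {b : ℝ} {φ : ℝ → ℝ} (h : IsTest b φ) : IsTest b (deriv φ) where
  smooth := (contDiff_infty_iff_deriv.1 h.smooth).2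
  compact := h.compact.deriv
  supp := (tsupport_deriv_subset (𝕜 := ℝ) (f := φ)).trans h.supp

theorem IsTest.memLp {b : ℝ} {φ : ℝ → ℝ} (h : IsTest b φ) (p : ℝ≥0∞) :
    MemLp (fun x => (φ x : ℂ)) p (μ b) := by
  have h1 : Continuous (fun x => (φ x : ℂ)) := Complex.continuous_ofReal.comp h.smooth.continuous
  exact (h1.memLp_of_hasCompactSupport (μ := volume)
    (h.compact.comp_left (g := Complex.ofReal) rfl)).restrict _

theorem IsTest.integrable_mul {b : ℝ} {φ : ℝ → ℝ} (h : IsTest b φ) (f : L2 b) :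
    Integrable (fun x => (φ x : ℂ) * f x) (μ b) :=
  (h.memLp 2).integrable_mul (Lp.memLp f)

theorem HasWeakDeriv.add {b : ℝ} {f g f' g' : L2 b} (h : HasWeakDeriv f g)
    (h' : HasWeakDeriv f' g') : HasWeakDeriv (f + f') (g + g') := by
  intro φ hφ
  have e (ψ : ℝ → ℝ) (hψ : IsTest b ψ) (u v : L2 b) :
      ∫ x in Ioo b (b + 1), ((ψ x : ℝ) : ℂ) * (u + v : L2 b) x =
        (∫ x in Ioo b (b + 1), ((ψ x : ℝ) : ℂ) * u x) +
          ∫ x in Ioo b (b + 1), ((ψ x : ℝ) : ℂ) * v x := by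
    rw [← integral_add (hψ.integrable_mul u) (hψ.integrable_mul v)]
    apply integral_congr_ae
    filter_upwards [Lp.coeFn_add u v] with x hx
    rw [hx, Pi.add_apply, mul_add]
  rw [e _ hφ.deriv, e _ hφ, h φ hφ, h' φ hφ]
  ring

theorem HasWeakDeriv.smul {b : ℝ} {f g : L2 b} (c : ℂ) (h : HasWeakDeriv f g) :
    HasWeakDeriv (c • f) (c • g) := by
  intro φ hφ
  have e (ψ : ℝ → ℝ) (u : L2 b) :
      ∫ x in Ioo b (b + 1), ((ψ x : ℝ) : ℂ) * (c • u : L2 b) x =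
        c * ∫ x in Ioo b (b + 1), ((ψ x : ℝ) : ℂ) * u x := by
    rw [← integral_const_mul]
    apply integral_congr_ae
    filter_upwards [Lp.coeFn_smul c u] with x hx
    rw [hx, Pi.smul_apply, smul_eq_mul]
    ring
  rw [e, e, h φ hφ]
  ring

theorem hasWeakDeriv_zero {b : ℝ} : HasWeakDeriv (0 : L2 b) 0 := by
  have e (ψ : ℝ → ℝ) : ∫ x in Ioo b (b + 1), ((ψ x : ℝ) : ℂ) * (0 : L2 b) x = 0 := by
    apply integral_eq_zero_of_ae
    filter_upwards [Lp.coeFn_zero ℂ 2 (μ b)] with x hx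
    rw [hx]
    simp
  intro φ _
  rw [e, e, neg_zero]

/-- An element of `L²(b, b + 1)` that annihilates all test functions is zero. -/
theorem eq_zero_of_test {b : ℝ} (g : L2 b)
    (h : ∀ φ : ℝ → ℝ, IsTest b φ → ∫ x in Ioo b (b + 1), ((φ x : ℝ) : ℂ) * g x = 0) :
    g = 0 := by
  have hint : IntegrableOn g (Ioo b (b + 1)) volume :=
    (Lp.memLp g).integrable (by norm_num)
  have h0 := isOpen_Ioo.ae_eq_zero_of_integral_contDiff_smul_eq_zero (μ := volume)
    (f := (g : ℝ → ℂ)) (U := Ioo b (b + 1)) hint.locallyIntegrableOn (by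
      intro φ h1 h2 h3
      rw [← h φ ⟨h1, h2, h3⟩, setIntegral_eq_integral_of_forall_compl_eq_zero]
      · simp only [Complex.real_smul]
      · intro x hx
        have : φ x = 0 := image_eq_zero_of_notMem_tsupport fun hx' => hx (h3 hx')
        simp [this])
  rw [Lp.eq_zero_iff_ae_eq_zero]
  exact (ae_restrict_iff' measurableSet_Ioo).2 h0

/-- The graph of weak differentiation in `L²(b, b + 1)`. -/
def weakDerivGraph (b : ℝ) : Submodule ℂ (L2 b × L2 b) where
  carrier := {p | HasWeakDeriv p.1 p.2}
  add_mem' h h' := HasWeakDeriv.add h h'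
  zero_mem' := hasWeakDeriv_zero
  smul_mem' c _ h := HasWeakDeriv.smul c h

theorem weakDerivGraph_functional (b : ℝ) (p : L2 b × L2 b) (hp : p ∈ weakDerivGraph b)
    (h0 : p.1 = 0) : p.2 = 0 := by
  refine eq_zero_of_test _ fun φ hφ => ?_
  have h : HasWeakDeriv p.1 p.2 := hp
  rw [h0] at h
  have h1 := h φ hφ
  rw [eq_comm, neg_eq_iff_eq_neg] at h1
  rw [h1, neg_eq_zero]
  apply integral_eq_zero_of_ae
  filter_upwards [Lp.coeFn_zero ℂ 2 (μ b)] with x hx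
  rw [hx]
  simp

/-- The weak derivative `u ↦ u'`, an unbounded operator in `L²(b, b + 1)` with domain
`H¹(b, b + 1)`. -/
def weakD (b : ℝ) : L2 b →ₗ.[ℂ] L2 b := (weakDerivGraph b).toLinearPMap

theorem mem_graph_weakD {b : ℝ} {f g : L2 b} :
    (f, g) ∈ (weakD b).graph ↔ HasWeakDeriv f g := by
  rw [weakD, Submodule.toLinearPMap_graph_eq _ (weakDerivGraph_functional b)]
  rfl

theorem mem_domain_weakD {b : ℝ} {f : L2 b} :
    f ∈ (weakD b).domain ↔ ∃ g, HasWeakDeriv f g := by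
  simp only [LinearPMap.mem_domain_iff, mem_graph_weakD]

/-- The Sobolev space `H²(b, b + 1)`: all `u ∈ L²` with weak derivatives `u', u'' ∈ L²`. -/
def H2 (b : ℝ) : Submodule ℂ (L2 b) where
  carrier := {u | ∃ u₁ u₂ : L2 b, HasWeakDeriv u u₁ ∧ HasWeakDeriv u₁ u₂}
  add_mem' := by
    rintro _ _ ⟨u₁, u₂, h1, h2⟩ ⟨v₁, v₂, h3, h4⟩
    exact ⟨u₁ + v₁, u₂ + v₂, h1.add h3, h2.add h4⟩
  zero_mem' := ⟨0, 0, hasWeakDeriv_zero, hasWeakDeriv_zero⟩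
  smul_mem' := by
    rintro c _ ⟨u₁, u₂, h1, h2⟩
    exact ⟨c • u₁, c • u₂, h1.smul c, h2.smul c⟩

/-- The product rule for multiplication by a power of `x`. -/
theorem HasWeakDeriv.rpowMul {b : ℝ} (hb : 0 < b) (s : ℝ) {f g : L2 b} (h : HasWeakDeriv f g) :
    HasWeakDeriv (powOp hb s f) (powOp hb s g + (s : ℂ) • powOp hb (s - 1) f) := by
  intro φ hφ
  have hpos : ∀ x ∈ Ioo b (b + 1), 0 < x := fun x hx => hb.trans hx.1
  -- `x ^ r φ` is again a test function
  have key (r : ℝ) : IsTest b (fun x => x ^ r * φ x) := by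
    refine ⟨?_, hφ.compact.mul_left, (tsupport_mul_subset_right).trans hφ.supp⟩
    rw [contDiff_iff_contDiffAt]
    intro x
    by_cases hx : x ∈ tsupport φ
    · exact (Real.contDiffAt_rpow_const_of_ne (hpos x (hφ.supp hx)).ne').mul hφ.smooth.contDiffAt
    · have : (fun x => x ^ r * φ x) =ᶠ[nhds x] fun _ => 0 := by
        filter_upwards [(isClosed_tsupport φ).isOpen_compl.mem_nhds hx] with y hy
        rw [image_eq_zero_of_notMem_tsupport hy, mul_zero]
      exact contDiffAt_const.congr_of_eventuallyEq this
  have hd : ∀ x ∈ Ioo b (b + 1), deriv (fun x => x ^ s * φ x) x =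
      s * (x ^ (s - 1) * φ x) + x ^ s * deriv φ x := by
    intro x hx
    have h1 := (Real.hasDerivAt_rpow_const (x := x) (p := s) (Or.inl (hpos x hx).ne'))
    have h2 := (hφ.smooth.differentiable (by simp) x).hasDerivAt
    have h3 : HasDerivAt (fun x => x ^ s * φ x) _ x := h1.mul h2
    rw [h3.deriv]
    ring
  have e1 : ∫ x in Ioo b (b + 1), ((deriv φ x : ℝ) : ℂ) * powOp hb s f x =
      (∫ x in Ioo b (b + 1), ((deriv (fun x => x ^ s * φ x) x : ℝ) : ℂ) * f x) -
        s * ∫ x in Ioo b (b + 1), ((x ^ (s - 1) * φ x : ℝ) : ℂ) * f x := by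
    rw [← integral_const_mul, ← integral_sub ((key s).deriv.integrable_mul f)
      (((key (s - 1)).integrable_mul f).const_mul _)]
    apply integral_congr_ae
    filter_upwards [coeFn_mulOp _ (memLp_rpow hb s) f, ae_restrict_mem measurableSet_Ioo]
      with x hx hxI
    rw [powOp, hx, hd x hxI]
    push_cast
    ring
  have e2 : ∫ x in Ioo b (b + 1), ((φ x : ℝ) : ℂ) *
        (powOp hb s g + (s : ℂ) • powOp hb (s - 1) f : L2 b) x =
      (∫ x in Ioo b (b + 1), ((x ^ s * φ x : ℝ) : ℂ) * g x) +
        s * ∫ x in Ioo b (b + 1), ((x ^ (s - 1) * φ x : ℝ) : ℂ) * f x := by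
    rw [← integral_const_mul, ← integral_add ((key s).integrable_mul g)
      (((key (s - 1)).integrable_mul f).const_mul _)]
    apply integral_congr_ae
    filter_upwards [coeFn_mulOp _ (memLp_rpow hb s) g, coeFn_mulOp _ (memLp_rpow hb (s - 1)) f,
      Lp.coeFn_add (powOp hb s g) ((s : ℂ) • powOp hb (s - 1) f),
      Lp.coeFn_smul (s : ℂ) (powOp hb (s - 1) f)] with x h1 h2 h3 h4
    rw [h3, Pi.add_apply, h4, Pi.smul_apply, powOp, powOp, h1, h2,
      smul_eq_mul]
    push_cast
    ring
  rw [e1, e2, h _ (key s)]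
  ring

/-! ### The form `h_b` and the operator `H_b` -/

theorem powOp_mem_domain {b : ℝ} (hb : 0 < b) (s : ℝ) (u : H2 b) :
    ((powOp hb s).comp (H2 b).subtype) u ∈ (weakD b).domain := by
  obtain ⟨u, u₁, u₂, h1, h2⟩ := u
  exact mem_domain_weakD.2 ⟨_, h1.rpowMul hb s⟩

/-- `u ↦ (x ^ (-β) u)'` on `H²(b, b + 1)`. -/
def firstOp {b : ℝ} (hb : 0 < b) (β : ℝ) : H2 b →ₗ[ℂ] L2 b :=
  (weakD b).toFun.comp
    (((powOp hb (-β)).comp (H2 b).subtype).codRestrict (weakD b).domain (powOp_mem_domain hb (-β)))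

theorem firstOp_mem_domain {b : ℝ} (hb : 0 < b) (α β : ℝ) (u : H2 b) :
    ((powOp hb (-α)).comp (firstOp hb β)) u ∈ (weakD b).domain := by
  obtain ⟨u, u₁, u₂, h1, h2⟩ := u
  have h3 : HasWeakDeriv (powOp hb (-β) u) (firstOp hb β ⟨u, u₁, u₂, h1, h2⟩) :=
    mem_graph_weakD.1 (LinearPMap.mem_graph (weakD b)
      ⟨powOp hb (-β) u, powOp_mem_domain hb (-β) ⟨u, u₁, u₂, h1, h2⟩⟩)
  have h4 : HasWeakDeriv (powOp hb (-β) u)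
      (powOp hb (-β) u₁ + ((-β : ℝ) : ℂ) • powOp hb (-β - 1) u) := h1.rpowMul hb (-β)
  have h5 := (weakD b).mem_graph_snd_inj (mem_graph_weakD.2 h3) (mem_graph_weakD.2 h4) rfl
  rw [LinearMap.comp_apply, h5]
  exact mem_domain_weakD.2
    ⟨_, ((h2.rpowMul hb (-β)).add ((h1.rpowMul hb (-β - 1)).smul _)).rpowMul hb (-α)⟩

/-- `u ↦ (x ^ (-α) (x ^ (-β) u)')'` on `H²(b, b + 1)`. -/
def secondOp {b : ℝ} (hb : 0 < b) (α β : ℝ) : H2 b →ₗ[ℂ] L2 b :=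
  (weakD b).toFun.comp
    (((powOp hb (-α)).comp (firstOp hb β)).codRestrict (weakD b).domain
      (firstOp_mem_domain hb α β))

/-- The sesquilinear form `h_b[u, v]` with domain `H²(b, b + 1)`, antilinear in `u`. -/
def form {b : ℝ} (hb : 0 < b) (α β : ℝ) (u v : H2 b) : ℂ :=
  ∫ x in Ioo b (b + 1),
    conj (secondOp hb α β u x) * secondOp hb α β v x * ((x ^ (2 * (α + β)) : ℝ) : ℂ)

theorem form_eq_inner {b : ℝ} (hb : 0 < b) (α β : ℝ) (u v : H2 b) :
    form hb α β u v =
      inner ℂ (secondOp hb α β u) (powOp hb (2 * (α + β)) (secondOp hb α β v)) := by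
  rw [L2.inner_def, form]
  apply integral_congr_ae
  filter_upwards [coeFn_mulOp _ (memLp_rpow hb (2 * (α + β))) (secondOp hb α β v)] with x hx
  rw [powOp, hx, RCLike.inner_apply]
  ring

/-- The graph of `H_b`: `u ∈ H²` and `h_b[v, u] = ⟨v, w⟩` for all `v ∈ H²`. -/
def opGraph {b : ℝ} (hb : 0 < b) (α β : ℝ) : Submodule ℂ (L2 b × L2 b) where
  carrier := {p | ∃ hu : p.1 ∈ H2 b, ∀ v : H2 b,
    form hb α β v ⟨p.1, hu⟩ = inner ℂ (v : L2 b) p.2}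
  add_mem' := by
    rintro ⟨u, w⟩ ⟨u', w'⟩ ⟨hu, h⟩ ⟨hu', h'⟩
    refine ⟨(H2 b).add_mem hu hu', fun v => ?_⟩
    have h1 := h v
    have h2 := h' v
    have e : (⟨u + u', (H2 b).add_mem hu hu'⟩ : H2 b) = ⟨u, hu⟩ + ⟨u', hu'⟩ := rfl
    simp only [form_eq_inner] at h1 h2 ⊢
    simp only [Prod.mk_add_mk, e, map_add, inner_add_right, h1, h2]
  zero_mem' := by
    refine ⟨(H2 b).zero_mem, fun v => ?_⟩
    have e : (⟨0, (H2 b).zero_mem⟩ : H2 b) = 0 := rfl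
    simp [form_eq_inner, e]
  smul_mem' := by
    rintro c ⟨u, w⟩ ⟨hu, h⟩
    refine ⟨(H2 b).smul_mem c hu, fun v => ?_⟩
    have h1 := h v
    have e : (⟨c • u, (H2 b).smul_mem c hu⟩ : H2 b) = c • ⟨u, hu⟩ := rfl
    simp only [form_eq_inner] at h1 ⊢
    simp only [Prod.smul_mk, e, map_smul, inner_smul_right, h1]

theorem IsTest.hasWeakDeriv {b : ℝ} {φ : ℝ → ℝ} (h : IsTest b φ) :
    HasWeakDeriv ((h.memLp 2).toLp : L2 b) ((h.deriv.memLp 2).toLp : L2 b) := by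
  intro ψ hψ
  have e (χ η : ℝ → ℝ) (hχ : IsTest b χ) (hη : MemLp (fun x => (η x : ℂ)) 2 (μ b)) :
      ∫ x in Ioo b (b + 1), ((χ x : ℝ) : ℂ) * (hη.toLp : L2 b) x =
        ((∫ x, χ x * η x : ℝ) : ℂ) := by
    rw [← integral_complex_ofReal, ← setIntegral_eq_integral_of_forall_compl_eq_zero
      (s := Ioo b (b + 1)) (f := fun x => ((χ x * η x : ℝ) : ℂ))]
    · apply integral_congr_ae
      filter_upwards [hη.coeFn_toLp] with x hx
      rw [hx]
      push_cast
      rfl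
    · intro x hx
      have : χ x = 0 := image_eq_zero_of_notMem_tsupport fun hx' => hx (hχ.supp hx')
      simp [this]
  rw [e _ _ hψ.deriv, e _ _ hψ, ← Complex.ofReal_neg]
  congr 1
  have hi (χ η : ℝ → ℝ) (hχ : IsTest b χ) (hη : IsTest b η) : Integrable (χ * η) :=
    (hχ.smooth.continuous.mul hη.smooth.continuous).integrable_of_hasCompactSupport
      hχ.compact.mul_right
  have hp := integral_mul_deriv_eq_deriv_mul_of_integrable
    (u := ψ) (v := φ) (u' := _root_.deriv ψ) (v' := _root_.deriv φ)
    (fun x _ => (hψ.smooth.differentiable (by simp) x).hasDerivAt)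
    (fun x _ => (h.smooth.differentiable (by simp) x).hasDerivAt)
    (hi _ _ hψ h.deriv) (hi _ _ hψ.deriv h) (hi _ _ hψ h)
  rw [hp, neg_neg]

/-- Since `H²(b, b + 1)` is dense in `L²(b, b + 1)`, the graph defines an operator. -/
theorem opGraph_functional {b : ℝ} (hb : 0 < b) (α β : ℝ) (p : L2 b × L2 b)
    (hp : p ∈ opGraph hb α β) (h0 : p.1 = 0) : p.2 = 0 := by
  obtain ⟨u, w⟩ := p
  obtain ⟨hu, h⟩ := hp
  obtain rfl : u = 0 := h0
  refine eq_zero_of_test _ fun φ hφ => ?_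
  have h1 := h ⟨(hφ.memLp 2).toLp, _, _, hφ.hasWeakDeriv, hφ.deriv.hasWeakDeriv⟩
  have e : (⟨0, hu⟩ : H2 b) = 0 := rfl
  simp only [form_eq_inner, e, map_zero, inner_zero_right] at h1
  rw [L2.inner_def] at h1
  rw [h1]
  apply integral_congr_ae
  filter_upwards [(hφ.memLp 2).coeFn_toLp] with x hx
  rw [hx, RCLike.inner_apply, Complex.conj_ofReal, mul_comm]

/-- `H_b`, the operator in `L²(b, b + 1)` associated with the form `h_b`. -/
def Hb {b : ℝ} (hb : 0 < b) (α β : ℝ) : L2 b →ₗ.[ℂ] L2 b := (opGraph hb α β).toLinearPMap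

theorem mem_graph_Hb {b : ℝ} (hb : 0 < b) (α β : ℝ) (u w : L2 b) :
    (u, w) ∈ (Hb hb α β).graph ↔
      ∃ hu : u ∈ H2 b, ∀ v : H2 b, form hb α β v ⟨u, hu⟩ = inner ℂ (v : L2 b) w := by
  rw [Hb, Submodule.toLinearPMap_graph_eq _ (opGraph_functional hb α β)]
  rfl

/-- `H_b - V` for a bounded potential `V`: the operator sum, with the domain of `H_b`. -/
def HbSub {b : ℝ} (hb : 0 < b) (α β : ℝ) (V : ℝ → ℝ) (hV : MemLp V ∞ (μ b)) :
    L2 b →ₗ.[ℂ] L2 b :=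
  Hb hb α β - (mulOp V hV).toPMap ⊤

/-! ### Spectrum of an unbounded operator -/

/-- `z` is in the resolvent set of `A`: `A - z` is a bijection from its domain onto the whole
space, with bounded inverse `R`. -/
def IsResolventPoint {X : Type*} [NormedAddCommGroup X] [NormedSpace ℂ X] (A : X →ₗ.[ℂ] X)
    (z : ℂ) : Prop :=
  ∃ R : X →L[ℂ] X,
    (∀ w : X, ∃ h : R w ∈ A.domain, A ⟨R w, h⟩ - z • R w = w) ∧
    ∀ u : A.domain, R (A u - z • (u : X)) = u

/-- The negative part of the spectrum of `A`. -/
def negSpectrum {X : Type*} [NormedAddCommGroup X] [NormedSpace ℂ X] (A : X →ₗ.[ℂ] X) : Set ℝ :=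
  {t | t < 0 ∧ ¬ IsResolventPoint A (t : ℂ)}

/-- The eigenspace `{u ∈ dom A : A u = z u}`. -/
def eigenspace {X : Type*} [NormedAddCommGroup X] [NormedSpace ℂ X] (A : X →ₗ.[ℂ] X) (z : ℂ) :
    Submodule ℂ X :=
  A.graph.comap (LinearMap.id.prod (z • LinearMap.id))

end IntervalOp

end

/-!
Solving `(x^{-α} (x^{-β} u)')' = x^{-(α+β)} g` by two integrations from `b + 1`, every
`u ∈ H²(b, b + 1)` is `c₀ x^β + c₁ x^{α+β+1} + S g` with `c ∈ ℂ²` and `g ∈ L²`, and `h_b[u] = ‖g‖²`.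
On the parameters `(c, g) ∈ ℂ² × L²` the form of `H_b - V` is therefore given by a bounded
self-adjoint operator.

A bound `|u(x)| ≤ C x^{ν/2} (‖g‖ + ‖u‖)` with `C` independent of `b` shows that, once
`∫ V x^ν` is small, the form is coercive on `{c = 0}` and at least `-‖u‖² / 2` everywhere. On the
plane `{g = 0}` it is `-∫ V |u|² < 0`, since a nonzero combination of `x^β` and `x^{α+β+1}` vanishes
at most once. Coercivity on a complement of finite dimension makes `H_b - V - z` Fredholm of index
zero for `z < 0`, so the negative spectrum consists of eigenvalues, and the two dimensions of the
plane force exactly two of them, all in `[-1/2, 0)`.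
-/

noncomputable section

namespace IntervalOp

theorem exists_mem_ne_zero_forall_eq_zero {𝕜 K ι : Type*} [Field 𝕜] [AddCommGroup K] [Module 𝕜 K]
    [Fintype ι] {N : Submodule 𝕜 K} [FiniteDimensional 𝕜 N]
    (h : Fintype.card ι < Module.finrank 𝕜 N) (f : ι → K →ₗ[𝕜] 𝕜) :
    ∃ x ∈ N, x ≠ 0 ∧ ∀ i, f i x = 0 := by
  obtain ⟨x, hfx, hx⟩ := (Submodule.ne_bot_iff _).1 (LinearMap.ker_ne_bot_of_finrank_lt
    (f := LinearMap.pi f ∘ₗ N.subtype) (by simpa using h))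
  exact ⟨x, x.2, by simpa using hx, congrFun hfx⟩

section Coercive

variable {𝕜 K : Type*} [RCLike 𝕜]

theorem isUnit_of_isCompactOperator_sub [NormedAddCommGroup K] [NormedSpace 𝕜 K]
    [CompleteSpace K] {B C : K →L[𝕜] K} (hC : IsUnit C) (hBC : IsCompactOperator (B - C))
    (hB : Function.Injective B) : IsUnit B := by
  obtain ⟨C, rfl⟩ := hC
  set S : K →L[𝕜] K := ↑C⁻¹ * (B - C) with hS
  have hBS : B = C * (S + 1) := by simp [hS, mul_sub]
  have hSc : IsCompactOperator S := hBC.clm_comp _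
  rcases hSc.hasEigenvalue_or_mem_resolventSet (neg_ne_zero.2 one_ne_zero) with h | h
  · obtain ⟨x, hx⟩ := h.exists_hasEigenvector
    refine absurd (hB (?_ : B x = B 0)) hx.2
    have hSx : S x = -x := by simpa using hx.apply_eq_smul
    simp [hBS, hSx]
  · rw [hBS]
    refine C.isUnit.mul ?_
    rw [spectrum.mem_resolventSet_iff, ← IsUnit.neg_iff] at h
    simpa [add_comm] using h

variable [NormedAddCommGroup K] [InnerProductSpace 𝕜 K]

theorem isCompactOperator_starProjection (N : Submodule 𝕜 K) [FiniteDimensional 𝕜 N] :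
    IsCompactOperator N.starProjection :=
  have h : IsCompactOperator N.subtypeL := isCompactOperator_of_locallyCompactSpace_rng _
  h.comp_clm N.orthogonalProjectionOnto

variable [CompleteSpace K]

theorem isUnit_of_coercive_on_orthogonal {B : K →L[𝕜] K} (N : Submodule 𝕜 K)
    [FiniteDimensional 𝕜 N] {c : ℝ} (hc : 0 < c)
    (hBN : ∀ k ∈ Nᗮ, c * ‖k‖ ^ 2 ≤ B.reApplyInnerSelf k) (hB : Function.Injective B) :
    IsUnit B := by
  set P := N.starProjection
  set Q := Nᗮ.starProjection
  have hPQ (k : K) : P k + Q k = k := by simp [P, Q, N.starProjection_orthogonal_val]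
  have hBC : B - (Q * B * Q + P) = P * B + Q * B * P - P := by
    ext k
    have hQB : Q (B (P k)) + Q (B (Q k)) = Q (B k) := by rw [← map_add, ← map_add, hPQ]
    simp only [sub_apply, add_apply, mul_apply_eq_comp]
    calc B k - (Q (B (Q k)) + P k)
        = P (B k) + (Q (B (P k)) + Q (B (Q k))) - (Q (B (Q k)) + P k) := by rw [hQB, hPQ]
      _ = P (B k) + Q (B (P k)) - P k := by abel
  refine isUnit_of_isCompactOperator_sub (C := Q * B * Q + P) ?_ ?_ hB
  · refine ContinuousLinearMap.isUnit_of_forall_le_norm_inner_map _ (c := ⟨min c 1, by positivity⟩)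
      (by simpa using hc : (0 : ℝ) < min c 1) fun k => ?_
    have h1 := hBN (Q k) (Nᗮ.starProjection_apply_mem k)
    have hform : RCLike.re (inner 𝕜 ((Q * B * Q + P) k) k) =
        B.reApplyInnerSelf (Q k) + ‖P k‖ ^ 2 := by
      simp only [add_apply, mul_apply_eq_comp, inner_add_left, map_add,
        ContinuousLinearMap.reApplyInnerSelf_apply]
      rw [Submodule.inner_starProjection_left_eq_right, N.re_inner_starProjection_eq_normSq]
      rfl
    have hk : ‖k‖ ^ 2 = ‖P k‖ ^ 2 + ‖Q k‖ ^ 2 := N.norm_sq_eq_add_norm_sq_starProjection k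
    calc ‖k‖ ^ 2 * min c 1 ≤ ‖P k‖ ^ 2 * 1 + ‖Q k‖ ^ 2 * c := by
          rw [hk, add_mul]
          gcongr
          exacts [min_le_right _ _, min_le_left _ _]
      _ ≤ RCLike.re (inner 𝕜 ((Q * B * Q + P) k) k) := by linarith
      _ ≤ _ := RCLike.re_le_norm _
  · have hP : IsCompactOperator P := isCompactOperator_starProjection N
    rw [hBC]
    exact ((hP.comp_clm B).add (hP.clm_comp (Q * B))).sub hP

end Coercive

theorem exists_pos_mul_norm_sq_le_reApplyInnerSelf {K : Type*} [NormedAddCommGroup K]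
    [InnerProductSpace ℂ K] [CompleteSpace K] [Nontrivial K] {B : K →L[ℂ] K} (hB : B.IsPositive)
    (hu : IsUnit B) : ∃ δ > 0, ∀ k, δ * ‖k‖ ^ 2 ≤ B.reApplyInnerSelf k := by
  have hB0 : 0 ≤ B := B.nonneg_iff_isPositive.2 hB
  obtain ⟨δ, hδ, h⟩ := (CFC.exists_pos_algebraMap_le_iff hB.isSelfAdjoint).2 fun x hx =>
    (hu.isStrictlyPositive hB0).spectrum_pos hx
  refine ⟨δ, hδ, fun k => ?_⟩
  have hk := h.re_inner_nonneg_left k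
  rw [Algebra.algebraMap_eq_smul_one, sub_apply, inner_sub_left, map_sub, sub_nonneg] at hk
  rw [smul_apply, RCLike.real_smul_eq_coe_smul (K := ℂ), inner_smul_left] at hk
  simpa [ContinuousLinearMap.reApplyInnerSelf_apply, ← Complex.ofReal_pow] using hk

theorem eigenspace_eq_bot_of_isResolventPoint {X : Type*} [NormedAddCommGroup X]
    [NormedSpace ℂ X] {A : X →ₗ.[ℂ] X} {z : ℂ} (h : IsResolventPoint A z) :
    eigenspace A z = ⊥ := by
  obtain ⟨R, -, hR⟩ := h
  refine (Submodule.eq_bot_iff _).2 fun u (hu : (u, z • u) ∈ A.graph) => ?_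
  obtain ⟨v, rfl, hv⟩ := (LinearPMap.mem_graph_iff A).1 hu
  simpa [hv] using (hR v).symm

section Pencil

variable {X K : Type*} [NormedAddCommGroup X] [InnerProductSpace ℂ X] [NormedAddCommGroup K]
  [InnerProductSpace ℂ K] {T : K →L[ℂ] K} {J : K →L[ℂ] X} {N : Submodule ℂ K} {c E s t : ℝ}

theorem exists_isGreatest_rayleigh_lowerBound (hE : ∀ k, E * ‖J k‖ ^ 2 ≤ T.reApplyInnerSelf k)
    (hneg : ∃ k, T.reApplyInnerSelf k < 0) :
    ∃ m < 0, IsGreatest {m : ℝ | ∀ k, m * ‖J k‖ ^ 2 ≤ T.reApplyInnerSelf k} m := by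
  set S := {m : ℝ | ∀ k, m * ‖J k‖ ^ 2 ≤ T.reApplyInnerSelf k}
  obtain ⟨k, hk⟩ := hneg
  have hS0 (m : ℝ) (hm : m ∈ S) : m < 0 := by
    by_contra! h
    nlinarith [hm k, sq_nonneg ‖J k‖]
  have hSc : IsClosed S := by
    simp only [S, ofPred_forall]
    exact isClosed_iInter fun k => isClosed_le (by fun_prop) continuous_const
  have hS := hSc.isGreatest_csSup ⟨E, hE⟩ ⟨0, fun m hm => (hS0 m hm).le⟩
  exact ⟨sSup S, hS0 _ hS.1, hS⟩

variable [CompleteSpace X] [CompleteSpace K]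

/-- The pencil `T - t J† J`. With `q[k] = ⟨T k, k⟩`, it represents the form `q[k] - t ‖J k‖²`;
its kernel consists of the solutions `k` of the weak eigenvalue equation for the form `q` regarded
as a form in `X` via the embedding `J`. -/
def pencil (T : K →L[ℂ] K) (J : K →L[ℂ] X) (t : ℝ) : K →L[ℂ] K :=
  T - (t : ℂ) • (J.adjoint ∘L J)

theorem pencil_apply (k : K) : pencil T J t k = T k - (t : ℂ) • J.adjoint (J k) := rfl

theorem pencil_apply_eq_zero_iff {k : K} :
    pencil T J t k = 0 ↔ T k = (t : ℂ) • J.adjoint (J k) := sub_eq_zero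

theorem isSelfAdjoint_pencil (hT : IsSelfAdjoint T) : IsSelfAdjoint (pencil T J t) :=
  hT.sub (.smul (Complex.conj_ofReal t) J.isPositive_adjoint_comp_self.isSelfAdjoint)

theorem reApplyInnerSelf_pencil (k : K) :
    (pencil T J t).reApplyInnerSelf k = T.reApplyInnerSelf k - t * ‖J k‖ ^ 2 := by
  simp only [ContinuousLinearMap.reApplyInnerSelf_apply, pencil_apply, inner_sub_left, map_sub,
    inner_smul_left, ContinuousLinearMap.adjoint_inner_left, inner_self_eq_norm_sq_to_K]
  simp [← Complex.ofReal_pow]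

theorem isUnit_pencil [FiniteDimensional ℂ N] (hc : 0 < c)
    (hN : ∀ k ∈ Nᗮ, c * ‖k‖ ^ 2 ≤ T.reApplyInnerSelf k) (ht : t ≤ 0)
    (hi : Function.Injective (pencil T J t)) : IsUnit (pencil T J t) :=
  isUnit_of_coercive_on_orthogonal N hc (fun k hk => by
    rw [reApplyInnerSelf_pencil]
    nlinarith [hN k hk, sq_nonneg ‖J k‖]) hi

theorem inner_eq_zero_of_pencil_eq_zero (hT : IsSelfAdjoint T) (hst : s ≠ t) {k k' : K}
    (hk : pencil T J s k = 0) (hk' : pencil T J t k' = 0) : inner ℂ (J k) (J k') = 0 := by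
  rw [pencil_apply_eq_zero_iff] at hk hk'
  have h : (s : ℂ) * inner ℂ (J k) (J k') = t * inner ℂ (J k) (J k') := by
    have := hT.isSymmetric k k'
    simpa only [ContinuousLinearMap.coe_coe, hk, hk', inner_smul_left, inner_smul_right,
      Complex.conj_ofReal, ContinuousLinearMap.adjoint_inner_left,
      ContinuousLinearMap.adjoint_inner_right] using this
  exact (mul_eq_mul_right_iff.1 h).resolve_left (by exact_mod_cast hst)

theorem not_isUnit_pencil_of_isGreatest [Nontrivial K] (hT : IsSelfAdjoint T) {m : ℝ}
    (hm : IsGreatest {m : ℝ | ∀ k, m * ‖J k‖ ^ 2 ≤ T.reApplyInnerSelf k} m) :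
    ¬ IsUnit (pencil T J m) := by
  intro hu
  have hpos : (pencil T J m).IsPositive :=
    ⟨(isSelfAdjoint_pencil hT).isSymmetric, fun k => by
      rw [reApplyInnerSelf_pencil]
      linarith [hm.1 k]⟩
  obtain ⟨δ, hδ, h⟩ := exists_pos_mul_norm_sq_le_reApplyInnerSelf hpos hu
  set M := ‖J‖ ^ 2 + 1
  have hM : 0 < M := by positivity
  have hmem : m + δ / M ∈ {m : ℝ | ∀ k, m * ‖J k‖ ^ 2 ≤ T.reApplyInnerSelf k} := fun k => by
    have hJ : ‖J k‖ ^ 2 ≤ M * ‖k‖ ^ 2 := by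
      have := pow_le_pow_left₀ (norm_nonneg _) (J.le_opNorm k) 2
      rw [mul_pow] at this
      nlinarith [sq_nonneg ‖k‖]
    have hδJ : δ / M * ‖J k‖ ^ 2 ≤ δ * ‖k‖ ^ 2 := by
      rw [div_mul_eq_mul_div, div_le_iff₀ hM]
      nlinarith
    have := h k
    rw [reApplyInnerSelf_pencil] at this
    linarith
  linarith [hm.2 hmem, div_pos hδ hM]

theorem exists_ground_state (hT : IsSelfAdjoint T) [FiniteDimensional ℂ N] (hc : 0 < c)
    (hN : ∀ k ∈ Nᗮ, c * ‖k‖ ^ 2 ≤ T.reApplyInnerSelf k)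
    (hE : ∀ k, E * ‖J k‖ ^ 2 ≤ T.reApplyInnerSelf k) (hneg : ∃ k, T.reApplyInnerSelf k < 0) :
    ∃ t < 0, ∃ k ≠ 0, pencil T J t k = 0 := by
  obtain ⟨m, hm0, hm⟩ := exists_isGreatest_rayleigh_lowerBound hE hneg
  have : Nontrivial K := by
    obtain ⟨k, hk⟩ := hneg
    refine ⟨k, 0, ?_⟩
    rintro rfl
    simp [ContinuousLinearMap.reApplyInnerSelf_apply] at hk
  refine ⟨m, hm0, ?_⟩
  by_contra! h
  refine not_isUnit_pencil_of_isGreatest hT hm (isUnit_pencil hc hN hm0.le ?_)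
  exact (injective_iff_map_eq_zero _).2 fun k hk => by_contra fun hk0 => h k hk0 hk

/-- Normalized eigenvectors `k i` of the pencil of `T` and `J` for negative eigenvalues `t i`. The
normalization takes place in `X`, where the eigenvectors are the `J (k i)`. -/
structure IsNegEigenfamily {ι : Type*} (T : K →L[ℂ] K) (J : K →L[ℂ] X) (t : ι → ℝ) (k : ι → K) :
    Prop where
  neg : ∀ i, t i < 0
  pencil_eq_zero : ∀ i, pencil T J (t i) (k i) = 0
  orthonormal : Orthonormal ℂ fun i => J (k i)

namespace IsNegEigenfamily

theorem exists_vecCons {n : ℕ} {t : Fin n → ℝ} {k : Fin n → K} (h : IsNegEigenfamily T J t k)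
    (hs : s < 0) {y : K} (hy : pencil T J s y = 0) (hJy : J y ≠ 0)
    (ho : ∀ i, inner ℂ (J y) (J (k i)) = 0) :
    ∃ y', IsNegEigenfamily T J (Matrix.vecCons s t) (Matrix.vecCons y' k) := by
  set a : ℂ := (‖J y‖ : ℂ)⁻¹
  have hJ : (fun i => J (Matrix.vecCons (a • y) k i)) =
      Matrix.vecCons (J (a • y)) fun i => J (k i) := by
    ext i
    cases i using Fin.cases <;> rfl
  have hpencil : pencil T J s (a • y) = 0 := by rw [map_smul, hy, smul_zero]
  refine ⟨a • y, Fin.cases hs h.neg, Fin.cases hpencil h.pencil_eq_zero, ?_⟩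
  rw [hJ, orthonormal_vecCons_iff]
  refine ⟨?_, fun i => ?_, h.orthonormal⟩
  · simp [a, norm_smul, hJy]
  · rw [map_smul, inner_smul_left, ho i, mul_zero]

variable {ι : Type*} {t : ι → ℝ} {k : ι → K}

theorem le (h : IsNegEigenfamily T J t k) (hE : ∀ k, E * ‖J k‖ ^ 2 ≤ T.reApplyInnerSelf k)
    (i : ι) : E ≤ t i := by
  have h0 := reApplyInnerSelf_pencil (T := T) (J := J) (t := t i) (k i)
  have h1 := hE (k i)
  rw [ContinuousLinearMap.reApplyInnerSelf_apply, h.pencil_eq_zero, inner_zero_left,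
    map_zero] at h0
  rw [h.orthonormal.norm_eq_one] at h0 h1
  linarith

variable [Fintype ι]

theorem reApplyInnerSelf_sum (h : IsNegEigenfamily T J t k) (c : ι → ℂ) :
    T.reApplyInnerSelf (∑ i, c i • k i) = ∑ i, t i * ‖c i‖ ^ 2 := by
  have hT : T (∑ i, c i • k i) = J.adjoint (∑ i, (c i * t i) • J (k i)) := by
    simp only [map_sum, map_smul, mul_smul, pencil_apply_eq_zero_iff.1 (h.pencil_eq_zero _)]
  rw [ContinuousLinearMap.reApplyInnerSelf_apply, hT, ContinuousLinearMap.adjoint_inner_left,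
    map_sum]
  simp only [map_smul]
  rw [h.orthonormal.inner_sum, map_sum]
  refine Finset.sum_congr rfl fun i _ => ?_
  have hi : conj (c i * t i) * c i = ((t i * ‖c i‖ ^ 2 : ℝ) : ℂ) := by
    rw [map_mul, Complex.conj_ofReal, mul_right_comm, Complex.conj_mul']
    push_cast
    ring
  rw [hi, RCLike.re_to_complex, Complex.ofReal_re]

/-- Otherwise the span of the `k i`, on which the form is negative, would meet `Nᗮ`. -/
theorem card_le_finrank (h : IsNegEigenfamily T J t k) [FiniteDimensional ℂ N]
    (hN : ∀ k ∈ Nᗮ, 0 ≤ T.reApplyInnerSelf k) : Fintype.card ι ≤ Module.finrank ℂ N := by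
  by_contra! hlt
  let f : (ι → ℂ) →ₗ[ℂ] N := N.orthogonalProjectionOnto ∘ₗ Fintype.linearCombination ℂ k
  obtain ⟨c, hfc, hc⟩ := (Submodule.ne_bot_iff _).1
    (LinearMap.ker_ne_bot_of_finrank_lt (f := f) (by simpa using hlt))
  have hmem : ∑ i, c i • k i ∈ Nᗮ := by
    rw [← Fintype.linearCombination_apply ℂ k c]
    exact N.orthogonalProjectionOnto_eq_zero_iff.1 hfc
  obtain ⟨i, hi⟩ := Function.ne_iff.1 hc
  refine absurd (hN _ hmem) (not_le.2 ?_)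
  rw [h.reApplyInnerSelf_sum]
  exact Finset.sum_neg' (fun j _ => mul_nonpos_of_nonpos_of_nonneg (h.neg j).le (by positivity))
    ⟨i, Finset.mem_univ i, mul_neg_of_neg_of_pos (h.neg i) (pow_pos (norm_pos_iff.2 hi) 2)⟩

end IsNegEigenfamily

/-- The operator of the form `q[k] - ∑ i, t i |⟨J (k i), J k⟩|²`. For a family of normalized
eigenvectors this moves the eigenvalues `t i` to zero and keeps the rest of the spectrum. -/
def deflation {ι : Type*} [Fintype ι] (T : K →L[ℂ] K) (J : K →L[ℂ] X) (t : ι → ℝ) (k : ι → K) :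
    K →L[ℂ] K :=
  T - ∑ i, (t i : ℂ) • InnerProductSpace.rankOne ℂ (J.adjoint (J (k i))) (J.adjoint (J (k i)))

section Deflation

variable {ι : Type*} [Fintype ι] {t : ι → ℝ} {k : ι → K}

theorem deflation_apply (x : K) : deflation T J t k x =
    T x - ∑ i, (t i : ℂ) • inner ℂ (J (k i)) (J x) • J.adjoint (J (k i)) := by
  simp [deflation, ContinuousLinearMap.adjoint_inner_left]

theorem isSelfAdjoint_deflation (hT : IsSelfAdjoint T) : IsSelfAdjoint (deflation T J t k) :=
  hT.sub <| isSelfAdjoint_sum _ fun i _ => .smul (Complex.conj_ofReal (t i))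
    (InnerProductSpace.isPositive_rankOne_self _).isSelfAdjoint

theorem reApplyInnerSelf_deflation (x : K) : (deflation T J t k).reApplyInnerSelf x =
    T.reApplyInnerSelf x - ∑ i, t i * ‖inner ℂ (J (k i)) (J x)‖ ^ 2 := by
  simp only [ContinuousLinearMap.reApplyInnerSelf_apply, deflation_apply, inner_sub_left,
    sum_inner, map_sub, map_sum, inner_smul_left, ContinuousLinearMap.adjoint_inner_left,
    Complex.conj_ofReal]
  simp only [Complex.conj_mul']
  simp [← Complex.ofReal_pow]

theorem IsNegEigenfamily.deflation_apply_self (h : IsNegEigenfamily T J t k) (i : ι) :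
    deflation T J t k (k i) = 0 := by
  classical
  have ho (j : ι) : inner ℂ (J (k j)) (J (k i)) = if j = i then 1 else 0 :=
    orthonormal_iff_ite.1 h.orthonormal j i
  simp [deflation_apply, ho, pencil_apply_eq_zero_iff.1 (h.pencil_eq_zero i)]

theorem pencil_deflation_of_inner_eq_zero {x : K} (hx : ∀ i, inner ℂ (J (k i)) (J x) = 0) :
    pencil (deflation T J t k) J s x = pencil T J s x := by
  simp [pencil_apply, deflation_apply, hx]

/-- The ground state of the deflation is orthogonal to the `k i`, which it annihilates. -/
theorem IsNegEigenfamily.exists_orthogonal (h : IsNegEigenfamily T J t k) (hT : IsSelfAdjoint T)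
    [FiniteDimensional ℂ N] (hn : Fintype.card ι < Module.finrank ℂ N) (hc : 0 < c)
    (hNc : ∀ k ∈ Nᗮ, c * ‖k‖ ^ 2 ≤ T.reApplyInnerSelf k)
    (hN : ∀ k ∈ N, k ≠ 0 → T.reApplyInnerSelf k < 0)
    (hE : ∀ k, E * ‖J k‖ ^ 2 ≤ T.reApplyInnerSelf k) :
    ∃ s < 0, ∃ y ≠ 0, pencil T J s y = 0 ∧ ∀ i, inner ℂ (J y) (J (k i)) = 0 := by
  have hle (x : K) : T.reApplyInnerSelf x ≤ (deflation T J t k).reApplyInnerSelf x := by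
    rw [reApplyInnerSelf_deflation, le_sub_self_iff]
    exact Finset.sum_nonpos fun i _ =>
      mul_nonpos_of_nonpos_of_nonneg (h.neg i).le (by positivity)
  obtain ⟨x, hxN, hx0, hx⟩ := exists_mem_ne_zero_forall_eq_zero hn fun i =>
    (innerSL ℂ (J (k i)) ∘L J).toLinearMap
  replace hx (i : ι) : inner ℂ (J (k i)) (J x) = 0 := hx i
  have hneg : (deflation T J t k).reApplyInnerSelf x < 0 := by
    simpa [reApplyInnerSelf_deflation, hx] using hN x hxN hx0
  obtain ⟨s, hs, y, hy0, hy⟩ := exists_ground_state (isSelfAdjoint_deflation hT) hc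
    (fun k hk => (hNc k hk).trans (hle k)) (fun k => (hE k).trans (hle k)) ⟨x, hneg⟩
  have ho (i : ι) : inner ℂ (J (k i)) (J y) = 0 :=
    inner_eq_zero_of_pencil_eq_zero (isSelfAdjoint_deflation hT) hs.ne'
      (by simp [pencil_apply, h.deflation_apply_self]) hy
  exact ⟨s, hs, y, hy0, by rwa [pencil_deflation_of_inner_eq_zero ho] at hy,
    fun i => inner_eq_zero_symm.1 (ho i)⟩

end Deflation

theorem exists_isNegEigenfamily (hT : IsSelfAdjoint T) (hJ : Function.Injective J)
    [FiniteDimensional ℂ N] (hc : 0 < c) (hNc : ∀ k ∈ Nᗮ, c * ‖k‖ ^ 2 ≤ T.reApplyInnerSelf k)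
    (hN : ∀ k ∈ N, k ≠ 0 → T.reApplyInnerSelf k < 0)
    (hE : ∀ k, E * ‖J k‖ ^ 2 ≤ T.reApplyInnerSelf k) {n : ℕ} (hn : n ≤ Module.finrank ℂ N) :
    ∃ (t : Fin n → ℝ) (k : Fin n → K), IsNegEigenfamily T J t k := by
  induction n with
  | zero => exact ⟨0, 0, ⟨nofun, nofun, .of_isEmpty _⟩⟩
  | succ n ih =>
    obtain ⟨t, k, h⟩ := ih (by lia)
    obtain ⟨s, hs, y, hy0, hy, ho⟩ := h.exists_orthogonal hT (by simpa using hn) hc hNc hN hE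
    obtain ⟨y', h'⟩ := h.exists_vecCons hs hy ((map_ne_zero_iff J hJ).2 hy0) ho
    exact ⟨_, _, h'⟩

/-- `A` is the operator in `X` of the form `⟨T k, k⟩`, regarded as a form in `X` via the
embedding `J`. -/
def IsRepresentedBy (A : X →ₗ.[ℂ] X) (T : K →L[ℂ] K) (J : K →L[ℂ] X) : Prop :=
  ∀ u w, (u, w) ∈ A.graph ↔ ∃ k, J k = u ∧ T k = J.adjoint w

section Spectrum

variable {A : X →ₗ.[ℂ] X}

theorem IsRepresentedBy.mem_eigenspace_iff (hA : IsRepresentedBy A T J) {u : X} :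
    u ∈ eigenspace A (s : ℂ) ↔ ∃ k, J k = u ∧ pencil T J s k = 0 := by
  change (u, (s : ℂ) • u) ∈ A.graph ↔ _
  rw [hA]
  refine exists_congr fun k => and_congr_right ?_
  rintro rfl
  rw [pencil_apply_eq_zero_iff, map_smul]

theorem IsRepresentedBy.isResolventPoint (hA : IsRepresentedBy A T J)
    (hu : IsUnit (pencil T J s)) : IsResolventPoint A (s : ℂ) := by
  obtain ⟨v, hv⟩ := hu
  let R : K →L[ℂ] K := ↑v⁻¹
  have hRv (x : K) : R (pencil T J s x) = x := by
    simpa [hv] using DFunLike.congr_fun v.inv_mul x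
  have hvR (x : K) : pencil T J s (R x) = x := by
    simpa [hv] using DFunLike.congr_fun v.mul_inv x
  refine ⟨J ∘L R ∘L J.adjoint, fun w => ?_, fun u => ?_⟩
  · have hg : (J (R (J.adjoint w)), w + (s : ℂ) • J (R (J.adjoint w))) ∈ A.graph := by
      refine (hA _ _).2 ⟨_, rfl, ?_⟩
      rw [map_add, map_smul, ← sub_eq_iff_eq_add, ← pencil_apply, hvR]
    obtain ⟨⟨_, hd⟩, rfl, hAd⟩ := (LinearPMap.mem_graph_iff A).1 hg
    exact ⟨hd, sub_eq_iff_eq_add.2 hAd⟩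
  · obtain ⟨x, hx, hTx⟩ := (hA _ _).1 (A.mem_graph u)
    have hpx : J.adjoint (A u - (s : ℂ) • (u : X)) = pencil T J s x := by
      rw [pencil_apply, hTx, map_sub, map_smul, hx]
    rw [ContinuousLinearMap.comp_apply, ContinuousLinearMap.comp_apply, hpx, hRv, hx]

theorem IsRepresentedBy.mem_negSpectrum_iff (hA : IsRepresentedBy A T J)
    (hJ : Function.Injective J) [FiniteDimensional ℂ N] (hc : 0 < c)
    (hNc : ∀ k ∈ Nᗮ, c * ‖k‖ ^ 2 ≤ T.reApplyInnerSelf k) :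
    s ∈ negSpectrum A ↔ s < 0 ∧ eigenspace A (s : ℂ) ≠ ⊥ := by
  refine and_congr_right fun hs =>
    ⟨fun h h0 => h (hA.isResolventPoint (isUnit_pencil hc hNc hs.le ?_)),
      fun h hr => h (eigenspace_eq_bot_of_isResolventPoint hr)⟩
  refine (injective_iff_map_eq_zero _).2 fun k hk => (map_eq_zero_iff J hJ).1 ?_
  exact (Submodule.eq_bot_iff _).1 h0 _ (hA.mem_eigenspace_iff.2 ⟨k, rfl, hk⟩)

variable {t : Fin (Module.finrank ℂ N) → ℝ} {k : Fin (Module.finrank ℂ N) → K}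

theorem IsNegEigenfamily.apply_eq_zero_of_inner_eq_zero (h : IsNegEigenfamily T J t k)
    [FiniteDimensional ℂ N] (hN : ∀ k ∈ Nᗮ, 0 ≤ T.reApplyInnerSelf k) (hs : s < 0) {y : K}
    (hy : pencil T J s y = 0) (ho : ∀ i, inner ℂ (J y) (J (k i)) = 0) : J y = 0 := by
  by_contra hJy
  obtain ⟨y', h'⟩ := h.exists_vecCons hs hy hJy ho
  simpa using h'.card_le_finrank hN

theorem IsNegEigenfamily.eigenspace_eq_span (h : IsNegEigenfamily T J t k)
    (hA : IsRepresentedBy A T J) (hT : IsSelfAdjoint T) [FiniteDimensional ℂ N]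
    (hN : ∀ k ∈ Nᗮ, 0 ≤ T.reApplyInnerSelf k) (hs : s < 0) :
    eigenspace A (s : ℂ) = Submodule.span ℂ (range fun i : {i // t i = s} => J (k i)) := by
  set S := Submodule.span ℂ (range fun i : {i // t i = s} => J (k i))
  have hSA : S ≤ eigenspace A (s : ℂ) := by
    refine Submodule.span_le.2 ?_
    rintro _ ⟨⟨i, rfl⟩, rfl⟩
    exact hA.mem_eigenspace_iff.2 ⟨k i, rfl, h.pencil_eq_zero i⟩
  have : FiniteDimensional ℂ S := FiniteDimensional.span_of_finite ℂ (finite_range _)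
  refine le_antisymm (fun u hu => ?_) hSA
  obtain ⟨y, hJy, hy⟩ := hA.mem_eigenspace_iff.1
    (Submodule.sub_mem _ hu (hSA (S.starProjection_apply_mem u)))
  have ho (i) : inner ℂ (J y) (J (k i)) = 0 := by
    by_cases hi : t i = s
    · rw [hJy]
      exact S.starProjection_inner_eq_zero u _ (Submodule.subset_span ⟨⟨i, hi⟩, rfl⟩)
    · exact inner_eq_zero_of_pencil_eq_zero hT (Ne.symm hi) hy (h.pencil_eq_zero i)
  rw [h.apply_eq_zero_of_inner_eq_zero hN hs hy ho, eq_comm, sub_eq_zero] at hJy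
  exact hJy ▸ S.starProjection_apply_mem u

theorem IsNegEigenfamily.rank_eigenspace (h : IsNegEigenfamily T J t k)
    (hA : IsRepresentedBy A T J) (hT : IsSelfAdjoint T) [FiniteDimensional ℂ N]
    (hN : ∀ k ∈ Nᗮ, 0 ≤ T.reApplyInnerSelf k) (hs : s < 0) :
    Module.rank ℂ (eigenspace A (s : ℂ)) = Fintype.card {i // t i = s} := by
  have hli : LinearIndependent ℂ fun i : {i // t i = s} => J (k i) :=
    h.orthonormal.linearIndependent.comp _ Subtype.val_injective
  have := FiniteDimensional.span_of_finite ℂ (finite_range fun i : {i // t i = s} => J (k i))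
  rw [h.eigenspace_eq_span hA hT hN hs, ← Module.finrank_eq_rank, finrank_span_eq_card hli]

/-- The Glazman variational principle. -/
theorem IsRepresentedBy.exists_negSpectrum_eq_range (hA : IsRepresentedBy A T J)
    (hT : IsSelfAdjoint T) (hJ : Function.Injective J) [FiniteDimensional ℂ N] (hc : 0 < c)
    (hNc : ∀ k ∈ Nᗮ, c * ‖k‖ ^ 2 ≤ T.reApplyInnerSelf k)
    (hN : ∀ k ∈ N, k ≠ 0 → T.reApplyInnerSelf k < 0)
    (hE : ∀ k, E * ‖J k‖ ^ 2 ≤ T.reApplyInnerSelf k) :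
    ∃ t : Fin (Module.finrank ℂ N) → ℝ, (∀ i, t i < 0 ∧ E ≤ t i) ∧ negSpectrum A = range t ∧
      ∀ s < 0, Module.rank ℂ (eigenspace A ((s : ℝ) : ℂ)) = Fintype.card {i // t i = s} := by
  obtain ⟨t, k, h⟩ := exists_isNegEigenfamily hT hJ hc hNc hN hE le_rfl
  have hrank {s : ℝ} (hs : s < 0) :=
    h.rank_eigenspace hA hT (fun k hk => (by positivity : 0 ≤ c * ‖k‖ ^ 2).trans (hNc k hk)) hs
  refine ⟨t, fun i => ⟨h.neg i, h.le hE i⟩, ?_, fun s hs => hrank hs⟩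
  ext s
  rw [hA.mem_negSpectrum_iff hJ hc hNc]
  have hbot (hs : s < 0) : eigenspace A (s : ℂ) ≠ ⊥ ↔ s ∈ range t := by
    rw [Ne, ← Submodule.rank_eq_zero, hrank hs, Nat.cast_eq_zero, Fintype.card_eq_zero_iff]
    simp
  exact ⟨fun ⟨hs, h⟩ => (hbot hs).1 h, fun hst =>
    have hs : s < 0 := by
      obtain ⟨i, rfl⟩ := hst
      exact h.neg i
    ⟨hs, (hbot hs).2 hst⟩⟩

end Spectrum

end Pencil

section Lp

variable {Ω : Type*} [MeasurableSpace Ω] {m : Measure Ω}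

theorem norm_sq_eq_integral (f : Lp ℂ 2 m) : ‖f‖ ^ 2 = ∫ x, ‖f x‖ ^ 2 ∂m := by
  rw [← Complex.ofReal_inj, ← integral_complex_ofReal]
  refine (Complex.ofReal_pow _ _).trans ((inner_self_eq_norm_sq_to_K (𝕜 := ℂ) f).symm.trans ?_)
  rw [L2.inner_def]
  refine integral_congr_ae (.of_forall fun x => ?_)
  simp only [inner_self_eq_norm_sq_to_K, Complex.coe_algebraMap, Complex.ofReal_pow]

theorem integral_mul_norm_le {k : Ω → ℝ} (hk : MemLp k 2 m) (hk0 : 0 ≤ᵐ[m] k) (f : Lp ℂ 2 m) :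
    ∫ x, k x * ‖f x‖ ∂m ≤ √(∫ x, k x ^ 2 ∂m) * ‖f‖ := by
  have h := integral_mul_le_Lp_mul_Lq_of_nonneg Real.HolderConjugate.two_two hk0
    (.of_forall fun x => norm_nonneg (f x)) (by simpa using hk) (by simpa using (Lp.memLp f).norm)
  rw [← Real.sqrt_sq (norm_nonneg f), norm_sq_eq_integral]
  simpa [Real.sqrt_eq_rpow] using h

theorem integral_norm_le [IsProbabilityMeasure m] (f : Lp ℂ 2 m) : ∫ x, ‖f x‖ ∂m ≤ ‖f‖ := by
  simpa using integral_mul_norm_le (memLp_const 1) (.of_forall fun _ => zero_le_one) f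

end Lp

section Tail

variable {m : Measure ℝ}

/-- The primitive `x ↦ ∫_x^∞ f` of `-f` with respect to `m`. -/
def tail (m : Measure ℝ) (f : ℝ → ℂ) (x : ℝ) : ℂ := ∫ s in Ioi x, f s ∂m

theorem tail_congr {f g : ℝ → ℂ} (h : f =ᵐ[m] g) : tail m f = tail m g :=
  funext fun _ => integral_congr_ae (ae_restrict_of_ae h)

theorem norm_tail_le {f : ℝ → ℂ} (hf : Integrable f m) (x : ℝ) :
    ‖tail m f x‖ ≤ ∫ s, ‖f s‖ ∂m :=
  (norm_integral_le_integral_norm _).trans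
    (setIntegral_le_integral hf.norm (.of_forall fun _ => norm_nonneg _))

theorem stronglyMeasurable_tail [SFinite m] {f : ℝ → ℂ} (hf : StronglyMeasurable f) :
    StronglyMeasurable (tail m f) := by
  have h : StronglyMeasurable ({p : ℝ × ℝ | p.1 < p.2}.indicator fun p => f p.2) :=
    (hf.comp_measurable measurable_snd).indicator (measurableSet_lt measurable_fst measurable_snd)
  convert h.integral_prod_right' (ν := m) using 2 with x
  rw [tail, ← integral_indicator measurableSet_Ioi]
  rfl

theorem integral_mul_tail [SFinite m] {φ f : ℝ → ℂ} (hφ : Integrable φ m) (hf : Integrable f m) :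
    ∫ x, φ x * tail m f x ∂m = ∫ s, (∫ x in Iio s, φ x ∂m) * f s ∂m := by
  have h : Integrable ({p : ℝ × ℝ | p.1 < p.2}.indicator fun p => φ p.1 * f p.2) (m.prod m) :=
    (hφ.mul_prod hf).indicator (measurableSet_lt measurable_fst measurable_snd)
  convert integral_integral_swap (f := fun x s =>
    {p : ℝ × ℝ | p.1 < p.2}.indicator (fun p => φ p.1 * f p.2) (x, s)) h using 3 with x s
  · rw [tail, ← integral_const_mul, ← integral_indicator measurableSet_Ioi]
    rfl
  · rw [← integral_mul_const, ← integral_indicator measurableSet_Iio]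
    rfl

theorem tail_mul_tail [SFinite m] {φ f : ℝ → ℂ} (hφ : Integrable φ m) (hf : Integrable f m)
    (x : ℝ) :
    tail m (φ * tail m f) x = ∫ s in Ioi x, (∫ t in Ioo x s, φ t ∂m) * f s ∂m := by
  have htail : ∀ t ∈ Ioi x, (φ * tail m f) t = φ t * tail (m.restrict (Ioi x)) f t := by
    intro t ht
    rw [Pi.mul_apply, tail, tail, Measure.restrict_restrict measurableSet_Ioi,
      inter_eq_left.2 (Ioi_subset_Ioi (le_of_lt ht))]
  rw [tail, setIntegral_congr_fun measurableSet_Ioi htail,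
    integral_mul_tail hφ.restrict hf.restrict]
  simp only [Measure.restrict_restrict measurableSet_Iio, Iio_inter_Ioi]

end Tail

variable {b : ℝ}

instance : IsProbabilityMeasure (μ b) := ⟨by simp⟩

theorem integrable_coe (f : L2 b) : Integrable f (μ b) := (Lp.memLp f).integrable (by norm_num)

theorem norm_le_of_ae_norm_le {C : ℝ} (hC : 0 ≤ C) {f : L2 b} (h : ∀ᵐ x ∂(μ b), ‖f x‖ ≤ C) :
    ‖f‖ ≤ C :=
  (Lp.norm_le_of_ae_bound hC h).trans_eq (by simp [measureUnivNNReal])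

section Multiplication

/-- `mulOp` as a bounded operator. -/
def mulL (m : ℝ → ℝ) (hm : MemLp m ∞ (μ b)) : L2 b →L[ℂ] L2 b :=
  (mulOp m hm).mkContinuous ‖hm.toLp m‖ fun u => Lp.norm_smul_le (hm.toLp m) u

theorem mulL_apply (m : ℝ → ℝ) (hm : MemLp m ∞ (μ b)) (u : L2 b) : mulL m hm u = mulOp m hm u := rfl

theorem inner_mulOp_left (m : ℝ → ℝ) (hm : MemLp m ∞ (μ b)) (u v : L2 b) :
    inner ℂ (mulOp m hm u) v = inner ℂ u (mulOp m hm v) := by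
  rw [L2.inner_def, L2.inner_def]
  apply integral_congr_ae
  filter_upwards [coeFn_mulOp m hm u, coeFn_mulOp m hm v] with x h1 h2
  rw [h1, h2, RCLike.inner_apply, RCLike.inner_apply, map_mul, Complex.conj_ofReal]
  ring

theorem coeFn_powOp (hb : 0 < b) (s : ℝ) (u : L2 b) :
    powOp hb s u =ᵐ[μ b] fun x => ((x ^ s : ℝ) : ℂ) * u x :=
  coeFn_mulOp _ _ u

theorem inner_powOp_left (hb : 0 < b) (s : ℝ) (u v : L2 b) :
    inner ℂ (powOp hb s u) v = inner ℂ u (powOp hb s v) :=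
  inner_mulOp_left _ _ u v

theorem powOp_powOp (hb : 0 < b) (s r : ℝ) (u : L2 b) :
    powOp hb s (powOp hb r u) = powOp hb (s + r) u := by
  apply Lp.ext
  filter_upwards [coeFn_powOp hb s (powOp hb r u), coeFn_powOp hb r u, coeFn_powOp hb (s + r) u,
    ae_restrict_mem measurableSet_Ioo] with x h1 h2 h3 hx
  rw [h1, h2, h3, Real.rpow_add (hb.trans hx.1)]
  push_cast
  ring

theorem powOp_zero (hb : 0 < b) (u : L2 b) : powOp hb 0 u = u := by
  apply Lp.ext
  filter_upwards [coeFn_powOp hb 0 u] with x h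
  rw [h, Real.rpow_zero, Complex.ofReal_one, one_mul]

theorem powOp_neg_powOp (hb : 0 < b) (s : ℝ) (u : L2 b) : powOp hb (-s) (powOp hb s u) = u := by
  rw [powOp_powOp, neg_add_cancel, powOp_zero]

theorem powOp_powOp_neg (hb : 0 < b) (s : ℝ) (u : L2 b) : powOp hb s (powOp hb (-s) u) = u := by
  rw [powOp_powOp, add_neg_cancel, powOp_zero]

/-- `powOp` as a bounded operator. -/
def powL (hb : 0 < b) (s : ℝ) : L2 b →L[ℂ] L2 b := mulL (fun x => x ^ s) (memLp_rpow hb s)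

end Multiplication

section TestFunctions

variable {φ : ℝ → ℝ}

theorem IsTest.hasDerivAt (h : IsTest b φ) (x : ℝ) : HasDerivAt φ (_root_.deriv φ x) x :=
  (h.smooth.differentiable (by simp) x).hasDerivAt

theorem IsTest.integrable (h : IsTest b φ) : Integrable φ :=
  h.smooth.continuous.integrable_of_hasCompactSupport h.compact

theorem IsTest.eq_zero_of_notMem (h : IsTest b φ) {x : ℝ} (hx : x ∉ Ioo b (b + 1)) : φ x = 0 :=
  image_eq_zero_of_notMem_tsupport fun hx' => hx (h.supp hx')

theorem IsTest.setIntegral_eq_integral (h : IsTest b φ) :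
    ∫ x in Ioo b (b + 1), ((φ x : ℝ) : ℂ) = ((∫ x, φ x : ℝ) : ℂ) := by
  rw [integral_complex_ofReal,
    setIntegral_eq_integral_of_forall_compl_eq_zero fun _ => h.eq_zero_of_notMem]

theorem IsTest.sub_const_mul {ψ : ℝ → ℝ} (h : IsTest b φ) (h' : IsTest b ψ) (c : ℝ) :
    IsTest b (fun x => φ x - c * ψ x) where
  smooth := h.smooth.sub (contDiff_const.mul h'.smooth)
  compact := h.compact.sub (h'.compact.mul_left (f := fun _ => c))
  supp := (tsupport_sub φ (fun x => c * ψ x)).trans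
    (union_subset h.supp ((tsupport_mul_subset_right (f := fun _ => c)).trans h'.supp))

theorem IsTest.setIntegral_Iio_deriv (h : IsTest b φ) {s : ℝ} (hs : s ∈ Ioo b (b + 1)) :
    ∫ x in Iio s, ((_root_.deriv φ x : ℝ) : ℂ) ∂(μ b) = φ s := by
  have hμ : (μ b).restrict (Iio s) = volume.restrict (Ioo b s) := by
    rw [Measure.restrict_restrict measurableSet_Iio, inter_comm, Ioo_inter_Iio,
      min_eq_right hs.2.le]
  rw [hμ, integral_complex_ofReal, ← integral_Ioc_eq_integral_Ioo,
    ← intervalIntegral.integral_of_le hs.1.le,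
    intervalIntegral.integral_eq_sub_of_hasDerivAt (fun x _ => h.hasDerivAt x)
      (h.deriv.smooth.continuous.intervalIntegrable _ _),
    h.eq_zero_of_notMem fun hx => hx.1.false, sub_zero]

theorem IsTest.exists_tsupport_subset_Icc (h : IsTest b φ) :
    ∃ l r, b < l ∧ r < b + 1 ∧ tsupport φ ⊆ Icc l r := by
  have hK : IsCompact (insert (b + 1 / 2) (tsupport φ)) := h.compact.isCompact.insert _
  have hsub : insert (b + 1 / 2) (tsupport φ) ⊆ Ioo b (b + 1) :=
    insert_subset ⟨by linarith, by linarith⟩ h.supp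
  obtain ⟨l, hl, hl'⟩ := hK.exists_isLeast (insert_nonempty _ _)
  obtain ⟨r, hr, hr'⟩ := hK.exists_isGreatest (insert_nonempty _ _)
  exact ⟨l, r, (hsub hl).1, (hsub hr).2, fun x hx =>
    ⟨hl' (mem_insert_of_mem _ hx), hr' (mem_insert_of_mem _ hx)⟩⟩

theorem IsTest.exists_deriv_eq (h : IsTest b φ) (h0 : ∫ x, φ x = 0) :
    ∃ ψ, IsTest b ψ ∧ _root_.deriv ψ = φ := by
  obtain ⟨l, r, hl, hr, hsupp⟩ := h.exists_tsupport_subset_Icc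
  have hφ : ∀ x ∉ Icc l r, φ x = 0 := fun x hx =>
    image_eq_zero_of_notMem_tsupport fun hx' => hx (hsupp hx')
  have hc : Continuous φ := h.smooth.continuous
  let ψ : ℝ → ℝ := fun x => ∫ t in b..x, φ t
  have hd : ∀ x, HasDerivAt ψ (φ x) x := fun x =>
    intervalIntegral.integral_hasDerivAt_right (hc.intervalIntegrable _ _)
      (hc.stronglyMeasurableAtFilter _ _) hc.continuousAt
  have hdψ : _root_.deriv ψ = φ := funext fun x => (hd x).deriv
  have hψ : ∀ x ∉ Icc l r, ψ x = 0 := by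
    intro x hx
    rw [mem_Icc, not_and_or, not_le, not_le] at hx
    rcases hx with hx | hx
    · have hzero : EqOn φ 0 (uIcc b x) := fun t ht => hφ t fun ht' =>
        (ht'.1.trans ht.2).not_gt (max_lt hl hx)
      simp only [ψ, intervalIntegral.integral_congr hzero, Pi.zero_apply,
        intervalIntegral.integral_zero]
    · refine (intervalIntegral.integral_eq_integral_of_support_subset fun t ht => ?_).trans h0
      have ht' : t ∈ Icc l r := not_not.1 fun ht' => ht (hφ t ht')
      exact ⟨hl.trans_le ht'.1, ht'.2.trans hx.le⟩
  have hψsupp : tsupport ψ ⊆ Icc l r :=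
    closure_minimal (fun x hx => not_not.1 fun hx' => hx (hψ x hx')) isClosed_Icc
  exact ⟨ψ, ⟨contDiff_infty_iff_deriv.2 ⟨fun x => (hd x).differentiableAt, hdψ ▸ h.smooth⟩,
    .intro isCompact_Icc hψ, hψsupp.trans (Icc_subset_Ioo hl hr)⟩, hdψ⟩

theorem exists_isTest_integral_eq_one (b : ℝ) : ∃ χ, IsTest b χ ∧ ∫ x, χ x = 1 := by
  let B : ContDiffBump (b + 1 / 2) := ⟨1 / 8, 1 / 4, by norm_num, by norm_num⟩
  refine ⟨B.normed volume, ⟨B.contDiff_normed, B.hasCompactSupport_normed, ?_⟩, B.integral_normed⟩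
  rw [B.tsupport_normed_eq, Real.closedBall_eq_Icc]
  refine Icc_subset_Ioo ?_ ?_ <;> simp only [B] <;> linarith

end TestFunctions

section WeakDeriv

/-- The constant function one. -/
def one (b : ℝ) : L2 b := Lp.const 2 (μ b) 1

theorem coeFn_one : one b =ᵐ[μ b] fun _ => (1 : ℂ) := Lp.coeFn_const ..

theorem integral_mul_coeFn_zero (φ : ℝ → ℂ) : ∫ x, φ x * (0 : L2 b) x ∂(μ b) = 0 := by
  refine integral_eq_zero_of_ae ?_
  filter_upwards [Lp.coeFn_zero ℂ 2 (μ b)] with x hx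
  rw [hx, Pi.zero_apply, mul_zero]

theorem hasWeakDeriv_one : HasWeakDeriv (one b) 0 := by
  intro φ hφ
  have h : ∫ x in Ioo b (b + 1), ((deriv φ x : ℝ) : ℂ) * one b x =
      ∫ x in Ioo b (b + 1), ((deriv φ x : ℝ) : ℂ) := by
    apply integral_congr_ae
    filter_upwards [coeFn_one (b := b)] with x hx
    rw [hx, mul_one]
  rw [h, integral_mul_coeFn_zero, hφ.deriv.setIntegral_eq_integral, neg_zero,
    integral_eq_zero_of_hasDerivAt_of_integrable hφ.hasDerivAt hφ.deriv.integrable hφ.integrable,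
    Complex.ofReal_zero]

theorem HasWeakDeriv.integral_mul_eq_zero {f : L2 b} (h : HasWeakDeriv f 0) {η : ℝ → ℝ}
    (hη : IsTest b η) (h0 : ∫ x, η x = 0) :
    ∫ x in Ioo b (b + 1), ((η x : ℝ) : ℂ) * f x = 0 := by
  obtain ⟨φ, hφ, rfl⟩ := hη.exists_deriv_eq h0
  rw [h φ hφ, integral_mul_coeFn_zero, neg_zero]

theorem integral_mul_sub_smul_one {ψ : ℝ → ℝ} (hψ : IsTest b ψ) (f : L2 b) (c : ℂ) :
    ∫ x in Ioo b (b + 1), ((ψ x : ℝ) : ℂ) * (f - c • one b : L2 b) x =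
      (∫ x in Ioo b (b + 1), ((ψ x : ℝ) : ℂ) * f x) - ((∫ x, ψ x : ℝ) : ℂ) * c := by
  rw [← hψ.setIntegral_eq_integral, ← integral_mul_const,
    ← integral_sub (hψ.integrable_mul f) (((hψ.memLp 1).integrable le_rfl).mul_const _)]
  apply integral_congr_ae
  filter_upwards [Lp.coeFn_sub f (c • one b), Lp.coeFn_smul c (one b), coeFn_one (b := b)]
    with x hsub hsmul hone
  rw [hsub, Pi.sub_apply, hsmul, Pi.smul_apply, hone, smul_eq_mul, mul_one, mul_sub]

theorem HasWeakDeriv.exists_eq_smul_one {f : L2 b} (h : HasWeakDeriv f 0) :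
    ∃ c : ℂ, f = c • one b := by
  obtain ⟨χ, hχ, hχ1⟩ := exists_isTest_integral_eq_one b
  refine ⟨∫ x in Ioo b (b + 1), ((χ x : ℝ) : ℂ) * f x,
    sub_eq_zero.1 (eq_zero_of_test _ fun ψ hψ => ?_)⟩
  have hη := h.integral_mul_eq_zero (hψ.sub_const_mul hχ (∫ x, ψ x)) (by
    rw [integral_sub hψ.integrable (hχ.integrable.const_mul _), integral_const_mul, hχ1, mul_one,
      sub_self])
  rw [integral_mul_sub_smul_one hψ, ← hη, ← integral_const_mul,
    ← integral_sub (hψ.integrable_mul f) ((hχ.integrable_mul f).const_mul _)]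
  refine integral_congr_ae (.of_forall fun x => ?_)
  push_cast
  ring

theorem HasWeakDeriv.unique {f g g' : L2 b} (h : HasWeakDeriv f g) (h' : HasWeakDeriv f g') :
    g = g' :=
  (weakD b).mem_graph_snd_inj (mem_graph_weakD.2 h) (mem_graph_weakD.2 h') rfl

theorem memLp_tail (f : L2 b) : MemLp (tail (μ b) f) 2 (μ b) :=
  .of_bound (stronglyMeasurable_tail (Lp.stronglyMeasurable f)).aestronglyMeasurable _
    (.of_forall (norm_tail_le (integrable_coe f)))

theorem norm_toLp_tail_le (f : L2 b) : ‖((memLp_tail f).toLp : L2 b)‖ ≤ ‖f‖ := by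
  refine norm_le_of_ae_norm_le (norm_nonneg f) ?_
  filter_upwards [(memLp_tail f).coeFn_toLp] with x hx
  exact hx ▸ (norm_tail_le (integrable_coe f) x).trans (integral_norm_le f)

/-- The operator `f ↦ ∫_x^{b+1} f(s) ds` on `L²(b, b + 1)`. -/
def tailL (b : ℝ) : L2 b →L[ℂ] L2 b :=
  LinearMap.mkContinuous
    { toFun := fun f => (memLp_tail f).toLp
      map_add' := fun f g => by
        rw [← MemLp.toLp_add]
        refine MemLp.toLp_congr _ _ (.of_forall fun x => ?_)
        rw [tail_congr (Lp.coeFn_add f g)]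
        exact integral_add (integrable_coe f).restrict (integrable_coe g).restrict
      map_smul' := fun c f => by
        rw [RingHom.id_apply, ← MemLp.toLp_const_smul]
        refine MemLp.toLp_congr _ _ (.of_forall fun x => ?_)
        rw [tail_congr (Lp.coeFn_smul c f)]
        exact integral_smul c _ }
    1 fun f => (norm_toLp_tail_le f).trans_eq (one_mul _).symm

theorem coeFn_tailL (f : L2 b) : tailL b f =ᵐ[μ b] tail (μ b) f := (memLp_tail f).coeFn_toLp

theorem hasWeakDeriv_tailL (f : L2 b) : HasWeakDeriv (tailL b f) (-f) := by
  intro φ hφ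
  calc ∫ x in Ioo b (b + 1), ((deriv φ x : ℝ) : ℂ) * tailL b f x
      = ∫ x in Ioo b (b + 1), ((deriv φ x : ℝ) : ℂ) * tail (μ b) f x := by
        apply integral_congr_ae
        filter_upwards [coeFn_tailL f] with x hx
        rw [hx]
    _ = ∫ s in Ioo b (b + 1), (∫ x in Iio s, ((deriv φ x : ℝ) : ℂ) ∂(μ b)) * f s :=
        integral_mul_tail ((hφ.deriv.memLp 1).integrable le_rfl) (integrable_coe f)
    _ = -∫ s in Ioo b (b + 1), ((φ s : ℝ) : ℂ) * (-f : L2 b) s := by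
        rw [← integral_neg]
        apply integral_congr_ae
        filter_upwards [Lp.coeFn_neg f, ae_restrict_mem measurableSet_Ioo] with s hs hsI
        rw [hs, Pi.neg_apply, mul_neg, neg_neg, hφ.setIntegral_Iio_deriv hsI]

end WeakDeriv

section Parametrization

theorem hasWeakDeriv_firstOp (hb : 0 < b) (β : ℝ) (u : H2 b) :
    HasWeakDeriv (powOp hb (-β) u) (firstOp hb β u) :=
  mem_graph_weakD.1 (LinearPMap.mem_graph (weakD b) ⟨powOp hb (-β) u, powOp_mem_domain hb (-β) u⟩)

theorem hasWeakDeriv_secondOp (hb : 0 < b) (α β : ℝ) (u : H2 b) :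
    HasWeakDeriv (powOp hb (-α) (firstOp hb β u)) (secondOp hb α β u) :=
  mem_graph_weakD.1 (LinearPMap.mem_graph (weakD b)
    ⟨powOp hb (-α) (firstOp hb β u), firstOp_mem_domain hb α β u⟩)

theorem HasWeakDeriv.exists_eq_add_smul_one {f f' g : L2 b} (h : HasWeakDeriv f g)
    (h' : HasWeakDeriv f' g) : ∃ c : ℂ, f = f' + c • one b := by
  obtain ⟨c, hc⟩ := HasWeakDeriv.exists_eq_smul_one (f := f - f') (by
    simpa [sub_eq_add_neg] using h.add (h'.smul (-1)))
  exact ⟨c, by rw [← hc, add_sub_cancel]⟩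

/-- The functions `c₀ x ^ β + c₁ x ^ (α + β + 1)` annihilated by the form `h_b`. -/
def kerL (hb : 0 < b) (α β : ℝ) : EuclideanSpace ℂ (Fin 2) →L[ℂ] L2 b :=
  (EuclideanSpace.proj 0 : EuclideanSpace ℂ (Fin 2) →L[ℂ] ℂ).smulRight (powOp hb β (one b)) +
    (EuclideanSpace.proj 1 : EuclideanSpace ℂ (Fin 2) →L[ℂ] ℂ).smulRight
      (powOp hb (α + β + 1) (one b))

theorem kerL_apply (hb : 0 < b) (α β : ℝ) (c : EuclideanSpace ℂ (Fin 2)) :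
    kerL hb α β c = c 0 • powOp hb β (one b) + c 1 • powOp hb (α + β + 1) (one b) := rfl

/-- The solution operator `g ↦ u` of `(x ^ (-α) (x ^ (-β) u)')' = x ^ (-(α + β)) g` with
`u(b + 1) = u'(b + 1) = 0`. -/
def solL (hb : 0 < b) (α β : ℝ) : L2 b →L[ℂ] L2 b :=
  powL hb β ∘L tailL b ∘L powL hb α ∘L tailL b ∘L powL hb (-(α + β))

theorem solL_apply (hb : 0 < b) (α β : ℝ) (g : L2 b) :
    solL hb α β g = powOp hb β (tailL b (powOp hb α (tailL b (powOp hb (-(α + β)) g)))) := rfl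

/-- The parameters `(c, g)` of an element of `H²(b, b + 1)`, see `paramL`. -/
abbrev Param (b : ℝ) : Type := WithLp 2 (EuclideanSpace ℂ (Fin 2) × L2 b)

/-- The parametrization `(c, g) ↦ kerL c + solL g` of `H²(b, b + 1)`, which turns the form `h_b`
into `‖g‖²`. -/
def paramL (hb : 0 < b) (α β : ℝ) : Param b →L[ℂ] L2 b :=
  kerL hb α β ∘L WithLp.fstL 2 ℂ _ _ + solL hb α β ∘L WithLp.sndL 2 ℂ _ _

theorem paramL_apply (hb : 0 < b) (α β : ℝ) (k : Param b) :
    paramL hb α β k = kerL hb α β k.fst + solL hb α β k.snd := rfl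

theorem powOp_neg_paramL (hb : 0 < b) (α β : ℝ) (k : Param b) :
    powOp hb (-β) (paramL hb α β k) = k.fst 0 • one b + k.fst 1 • powOp hb (α + 1) (one b) +
      tailL b (powOp hb α (tailL b (powOp hb (-(α + β)) k.snd))) := by
  rw [paramL_apply, kerL_apply, solL_apply]
  simp only [map_add, map_smul, powOp_neg_powOp]
  rw [powOp_powOp, show -β + (α + β + 1) = α + 1 by ring]

theorem hasWeakDeriv_powOp_neg_paramL (hb : 0 < b) (α β : ℝ) (k : Param b) :
    HasWeakDeriv (powOp hb (-β) (paramL hb α β k)) (powOp hb α ((k.fst 1 * ((α + 1 : ℝ) : ℂ)) •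
      one b - tailL b (powOp hb (-(α + β)) k.snd))) := by
  have hpow : HasWeakDeriv (powOp hb (α + 1) (one b)) (((α + 1 : ℝ) : ℂ) • powOp hb α (one b)) := by
    simpa using (hasWeakDeriv_one (b := b)).rpowMul hb (α + 1)
  rw [powOp_neg_paramL]
  convert (((hasWeakDeriv_one (b := b)).smul (k.fst 0)).add (hpow.smul (k.fst 1))).add
    (hasWeakDeriv_tailL _) using 1
  rw [map_sub, map_smul, smul_zero, zero_add, smul_smul, sub_eq_add_neg]

theorem hasWeakDeriv_smul_one_sub_tailL (c : ℂ) (g : L2 b) :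
    HasWeakDeriv (c • one b - tailL b g) g := by
  simpa [sub_eq_add_neg] using
    ((hasWeakDeriv_one (b := b)).smul c).add ((hasWeakDeriv_tailL g).smul (-1))

theorem paramL_mem_H2 (hb : 0 < b) (α β : ℝ) (k : Param b) : paramL hb α β k ∈ H2 b := by
  have h1 := hasWeakDeriv_powOp_neg_paramL hb α β k
  have h2 := (hasWeakDeriv_smul_one_sub_tailL (k.fst 1 * ((α + 1 : ℝ) : ℂ))
    (powOp hb (-(α + β)) k.snd)).rpowMul hb α
  have h3 := h1.rpowMul hb β
  rw [powOp_powOp_neg] at h3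
  exact ⟨_, _, h3, (h2.rpowMul hb β).add ((h1.rpowMul hb (β - 1)).smul _)⟩

/-- `paramL` as a map into `H²(b, b + 1)`. -/
def paramH2 (hb : 0 < b) (α β : ℝ) (k : Param b) : H2 b :=
  ⟨paramL hb α β k, paramL_mem_H2 hb α β k⟩

theorem secondOp_paramH2 (hb : 0 < b) (α β : ℝ) (k : Param b) :
    secondOp hb α β (paramH2 hb α β k) = powOp hb (-(α + β)) k.snd := by
  have h := hasWeakDeriv_secondOp hb α β (paramH2 hb α β k)
  rw [(hasWeakDeriv_firstOp hb β (paramH2 hb α β k)).unique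
    (hasWeakDeriv_powOp_neg_paramL hb α β k), powOp_neg_powOp] at h
  exact h.unique (hasWeakDeriv_smul_one_sub_tailL _ _)

theorem paramH2_surjective (hb : 0 < b) {α : ℝ} (hα : 0 ≤ α) (β : ℝ) :
    Function.Surjective (paramH2 hb α β) := by
  intro u
  set f := firstOp hb β u
  set g := secondOp hb α β u
  have hα' : ((α + 1 : ℝ) : ℂ) ≠ 0 := Complex.ofReal_ne_zero.2 (by positivity)
  obtain ⟨c, hc⟩ := (hasWeakDeriv_secondOp hb α β u).exists_eq_add_smul_one
    (hasWeakDeriv_smul_one_sub_tailL 0 _)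
  set c₁ := c / ((α + 1 : ℝ) : ℂ) with hc₁
  let k (c₀ : ℂ) : Param b := WithLp.toLp 2 (!₂[c₀, c₁], powOp hb (α + β) g)
  have hk : HasWeakDeriv (powOp hb (-β) (paramL hb α β (k 0))) f := by
    convert hasWeakDeriv_powOp_neg_paramL hb α β (k 0) using 1
    change f = powOp hb α ((c₁ * _) • one b - tailL b (powOp hb _ (powOp hb (α + β) g)))
    rw [powOp_neg_powOp, hc₁, div_mul_cancel₀ c hα', ← powOp_powOp_neg hb α f, hc, zero_smul,
      zero_sub, neg_add_eq_sub]
  obtain ⟨c₀, hc₀⟩ := (hasWeakDeriv_firstOp hb β u).exists_eq_add_smul_one hk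
  have hu : powOp hb (-β) (paramL hb α β (k c₀)) = powOp hb (-β) (u : L2 b) := by
    rw [hc₀, powOp_neg_paramL, powOp_neg_paramL]
    change c₀ • one b + c₁ • _ + _ = (0 : ℂ) • one b + c₁ • _ + _ + c₀ • one b
    rw [zero_smul, zero_add, add_assoc, add_comm]
    rfl
  refine ⟨k c₀, Subtype.ext ?_⟩
  rw [← powOp_powOp_neg hb β (u : L2 b), ← hu, powOp_powOp_neg]
  rfl

theorem form_paramH2 (hb : 0 < b) (α β : ℝ) (k k' : Param b) :
    form hb α β (paramH2 hb α β k) (paramH2 hb α β k') = inner ℂ k.snd k'.snd := by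
  rw [form_eq_inner, secondOp_paramH2, secondOp_paramH2, inner_powOp_left, powOp_powOp, powOp_powOp,
    show -(α + β) + 2 * (α + β) + -(α + β) = 0 by ring, powOp_zero]

end Parametrization

section Representation

/-- The bounded self-adjoint operator on the parameter space whose quadratic form is
`h_b[u] - ∫ V |u|²` for `u = paramL k`. -/
def formOp (hb : 0 < b) (α β : ℝ) (V : ℝ → ℝ) (hV : MemLp V ∞ (μ b)) : Param b →L[ℂ] Param b :=
  (WithLp.sndL 2 ℂ _ _).adjoint ∘L WithLp.sndL 2 ℂ _ _ -
    (paramL hb α β).adjoint ∘L mulL V hV ∘L paramL hb α β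

variable (hb : 0 < b) (α β : ℝ) (V : ℝ → ℝ) (hV : MemLp V ∞ (μ b))

theorem inner_formOp (k k' : Param b) :
    inner ℂ k (formOp hb α β V hV k') =
      inner ℂ k.snd k'.snd - inner ℂ (paramL hb α β k) (mulOp V hV (paramL hb α β k')) := by
  simp only [formOp, sub_apply, ContinuousLinearMap.comp_apply, inner_sub_right,
    ContinuousLinearMap.adjoint_inner_right, mulL_apply]
  rfl

theorem isSelfAdjoint_formOp : IsSelfAdjoint (formOp hb α β V hV) := by
  rw [ContinuousLinearMap.isSelfAdjoint_iff_isSymmetric]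
  intro k k'
  simp only [ContinuousLinearMap.coe_coe]
  rw [inner_formOp, ← inner_conj_symm, inner_formOp, map_sub, inner_conj_symm, inner_conj_symm,
    inner_mulOp_left]

theorem reApplyInnerSelf_formOp (k : Param b) :
    (formOp hb α β V hV).reApplyInnerSelf k = ‖k.snd‖ ^ 2 -
      (inner ℂ (paramL hb α β k) (mulOp V hV (paramL hb α β k))).re := by
  rw [ContinuousLinearMap.reApplyInnerSelf_apply, inner_re_symm, inner_formOp, map_sub,
    inner_self_eq_norm_sq]
  rfl

theorem mem_graph_HbSub (u w : L2 b) :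
    (u, w) ∈ (HbSub hb α β V hV).graph ↔ (u, w + mulOp V hV u) ∈ (Hb hb α β).graph := by
  simp only [LinearPMap.mem_graph_iff, HbSub]
  constructor
  · rintro ⟨y, rfl, rfl⟩
    exact ⟨⟨y, y.2.1⟩, rfl, (sub_add_cancel _ _).symm⟩
  · rintro ⟨y, rfl, hy⟩
    exact ⟨⟨y, y.2, trivial⟩, rfl, sub_eq_iff_eq_add.2 hy⟩

theorem isRepresentedBy_formOp {α : ℝ} (hα : 0 ≤ α) :
    IsRepresentedBy (HbSub hb α β V hV) (formOp hb α β V hV) (paramL hb α β) := by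
  intro u w
  have key (k k' : Param b) :
      form hb α β (paramH2 hb α β k') (paramH2 hb α β k) =
          inner ℂ (paramH2 hb α β k' : L2 b) (w + mulOp V hV (paramL hb α β k)) ↔
        inner ℂ k' (formOp hb α β V hV k) = inner ℂ k' ((paramL hb α β).adjoint w) := by
    rw [inner_formOp, form_paramH2, ContinuousLinearMap.adjoint_inner_right, inner_add_right,
      sub_eq_iff_eq_add]
    rfl
  rw [mem_graph_HbSub, mem_graph_Hb]
  constructor
  · rintro ⟨hu, h⟩
    obtain ⟨k, hk⟩ := paramH2_surjective hb hα β ⟨u, hu⟩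
    obtain rfl : paramL hb α β k = u := congrArg Subtype.val hk
    exact ⟨k, rfl, ext_inner_left ℂ fun k' => (key k k').1 (h _)⟩
  · rintro ⟨k, rfl, hk⟩
    refine ⟨paramL_mem_H2 hb α β k, fun v => ?_⟩
    obtain ⟨k', rfl⟩ := paramH2_surjective hb hα β v
    exact (key k k').2 (by rw [hk])

end Representation

section SolutionBound

variable {α β ν x s : ℝ}

/-- The integral kernel of `solL`. -/
def solKer (α β x s : ℝ) : ℝ := x ^ β * ((∫ t in x..s, t ^ α) * s ^ (-(α + β)))

theorem solKer_nonneg (hx : 0 ≤ x) (hxs : x ≤ s) : 0 ≤ solKer α β x s :=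
  mul_nonneg (Real.rpow_nonneg hx _) (mul_nonneg
    (intervalIntegral.integral_nonneg hxs fun _ ht => Real.rpow_nonneg (hx.trans ht.1) _)
    (Real.rpow_nonneg (hx.trans hxs) _))

theorem integral_rpow_le_mul_rpow (hα : 0 ≤ α) (hx : 0 ≤ x) (hxs : x ≤ s) :
    ∫ t in x..s, t ^ α ≤ (s - x) * s ^ α := by
  have h := intervalIntegral.integral_mono_on hxs
    (intervalIntegral.intervalIntegrable_rpow (μ := volume) (.inl hα)) intervalIntegrable_const
    fun t ht => Real.rpow_le_rpow (hx.trans ht.1) ht.2 hα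
  simpa using h

theorem solKer_le (hα : 0 ≤ α) (hν : 0 ≤ ν) (hνβ : ν ≤ 2 * β) (hx : 0 < x) (hxs : x < s) :
    solKer α β x s ≤ x ^ (ν / 2) * (s - x) ^ (1 - ν / 2) := by
  have hs : 0 < s := hx.trans hxs
  have hd : 0 < s - x := sub_pos.2 hxs
  calc solKer α β x s ≤ x ^ β * ((s - x) * s ^ α * s ^ (-(α + β))) := by
        rw [solKer]
        gcongr
        exact integral_rpow_le_mul_rpow hα hx.le hxs.le
    _ = x ^ (ν / 2) * (x ^ (β - ν / 2) * s ^ (-β) * (s - x)) := by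
        rw [neg_add, Real.rpow_add hs, Real.rpow_neg hs.le α, Real.rpow_sub hx]
        field_simp
    _ ≤ x ^ (ν / 2) * (s ^ (β - ν / 2) * s ^ (-β) * (s - x)) := by
        gcongr
        linarith
    _ = x ^ (ν / 2) * (s ^ (-(ν / 2)) * (s - x)) := by
        rw [← Real.rpow_add hs, show β - ν / 2 + -β = -(ν / 2) by ring]
    _ ≤ x ^ (ν / 2) * ((s - x) ^ (-(ν / 2)) * (s - x)) := by
        gcongr ?_ * (?_ * _)
        exact Real.rpow_le_rpow_of_nonpos hd (by linarith) (by linarith)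
    _ = x ^ (ν / 2) * (s - x) ^ (1 - ν / 2) := by
        rw [← Real.rpow_add_one hd.ne', neg_add_eq_sub]

theorem restrict_Ioi (hx : b ≤ x) : (μ b).restrict (Ioi x) = volume.restrict (Ioo x (b + 1)) := by
  rw [Measure.restrict_restrict measurableSet_Ioi, Ioi_inter_Ioo, max_eq_left hx]

theorem coeFn_solL (hb : 0 < b) (α β : ℝ) (g : L2 b) :
    solL hb α β g =ᵐ[μ b] fun x => ∫ s in Ioi x, solKer α β x s * g s ∂(μ b) := by
  have hα : Integrable (fun t => ((t ^ α : ℝ) : ℂ)) (μ b) :=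
    ((memLp_rpow hb α).integrable le_top).ofReal
  have hg : Integrable (fun s => ((s ^ (-(α + β)) : ℝ) : ℂ) * g s) (μ b) :=
    (integrable_coe _).congr (coeFn_powOp hb (-(α + β)) g)
  filter_upwards [coeFn_powOp hb β (tailL b (powOp hb α (tailL b (powOp hb (-(α + β)) g)))),
    coeFn_tailL (powOp hb α (tailL b (powOp hb (-(α + β)) g))), ae_restrict_mem measurableSet_Ioo]
    with x h1 h2 hx
  rw [solL_apply, h1, h2, tail_congr ((coeFn_powOp hb α _).trans (.mul .rfl (coeFn_tailL _))),
    tail_congr (coeFn_powOp hb _ g), tail_mul_tail hα hg, ← integral_const_mul,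
    restrict_Ioi hx.1.le]
  refine setIntegral_congr_fun measurableSet_Ioo fun s hs => ?_
  have hsub : Ioo x s ⊆ Ioo b (b + 1) := Ioo_subset_Ioo hx.1.le hs.2.le
  simp only [solKer]
  rw [Measure.restrict_restrict measurableSet_Ioo, inter_eq_left.2 hsub, integral_complex_ofReal,
    ← integral_Ioc_eq_integral_Ioo, ← intervalIntegral.integral_of_le hs.1.le]
  push_cast
  ring

theorem integrableOn_rpow_sub {r : ℝ} (hr : -1 < r) (x y : ℝ) :
    IntegrableOn (fun s => (s - x) ^ r) (Ioo x y) := by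
  have h := (intervalIntegral.intervalIntegrable_rpow' hr (a := 0) (b := y - x)).comp_sub_right x
  rw [zero_add, sub_add_cancel] at h
  exact h.1.mono_set Ioo_subset_Ioc_self

theorem setIntegral_rpow_sub {r y : ℝ} (hr : -1 < r) (hxy : x ≤ y) :
    ∫ s in Ioo x y, (s - x) ^ r = (y - x) ^ (r + 1) / (r + 1) := by
  rw [← integral_Ioc_eq_integral_Ioo, ← intervalIntegral.integral_of_le hxy,
    intervalIntegral.integral_comp_sub_right (fun t => t ^ r), integral_rpow (.inl hr), sub_self,
    Real.zero_rpow (by linarith), sub_zero]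

theorem indicator_rpow_sub_sq (r x : ℝ) :
    (fun s => (Ioi x).indicator (fun s => (s - x) ^ r) s ^ 2) =
      (Ioi x).indicator fun s => (s - x) ^ (2 * r) := by
  funext s
  by_cases hs : s ∈ Ioi x
  · rw [indicator_of_mem hs, indicator_of_mem hs, ← Real.rpow_natCast,
      ← Real.rpow_mul (sub_nonneg.2 (le_of_lt hs)), Nat.cast_ofNat, mul_comm]
  · rw [indicator_of_notMem hs, indicator_of_notMem hs, zero_pow two_ne_zero]

theorem memLp_indicator_rpow_sub {r : ℝ} (hr : -1 < 2 * r) (hx : b ≤ x) :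
    MemLp ((Ioi x).indicator fun s => (s - x) ^ r) 2 (μ b) := by
  have hmeas : Measurable ((Ioi x).indicator fun s : ℝ => (s - x) ^ r) :=
    ((measurable_id.sub_const x).pow_const r).indicator measurableSet_Ioi
  rw [memLp_two_iff_integrable_sq hmeas.aestronglyMeasurable, indicator_rpow_sub_sq,
    integrable_indicator_iff measurableSet_Ioi, IntegrableOn, restrict_Ioi hx]
  exact integrableOn_rpow_sub hr x (b + 1)

theorem integral_indicator_rpow_sub_sq_le {r : ℝ} (hr : -1 < 2 * r) (hx : x ∈ Ioo b (b + 1)) :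
    ∫ s, (Ioi x).indicator (fun s => (s - x) ^ r) s ^ 2 ∂(μ b) ≤ (2 * r + 1)⁻¹ := by
  have hr' : 0 < 2 * r + 1 := by linarith
  rw [indicator_rpow_sub_sq, integral_indicator measurableSet_Ioi, restrict_Ioi hx.1.le,
    setIntegral_rpow_sub hr hx.2.le, div_eq_mul_inv]
  exact mul_le_of_le_one_left (inv_nonneg.2 hr'.le)
    (Real.rpow_le_one (sub_nonneg.2 hx.2.le) (by linarith [hx.1]) hr'.le)

/-- The constant in the pointwise bound `norm_solL_le`. -/
def solConst (ν : ℝ) : ℝ := √(3 - ν)⁻¹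

theorem norm_solL_le (hb : 0 < b) (hα : 0 ≤ α) (hν : 0 ≤ ν) (hν3 : ν < 3) (hνβ : ν ≤ 2 * β)
    (g : L2 b) : ∀ᵐ x ∂(μ b), ‖solL hb α β g x‖ ≤ x ^ (ν / 2) * (solConst ν * ‖g‖) := by
  have hr : -1 < 2 * (1 - ν / 2) := by linarith
  filter_upwards [coeFn_solL hb α β g, ae_restrict_mem measurableSet_Ioo] with x hsol hx
  have hx0 : 0 < x := hb.trans hx.1
  set w : ℝ → ℝ := (Ioi x).indicator fun s => (s - x) ^ (1 - ν / 2) with hw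
  have hw2 : MemLp w 2 (μ b) := memLp_indicator_rpow_sub hr hx.1.le
  have hw0 : 0 ≤ w := indicator_nonneg fun s hs => Real.rpow_nonneg (sub_nonneg.2 (le_of_lt hs)) _
  have hwg : Integrable (fun s => x ^ (ν / 2) * (w s * ‖g s‖)) (μ b) :=
    (hw2.integrable_mul (Lp.memLp g).norm).const_mul _
  have hker : ∀ s ∈ Ioi x, ‖(solKer α β x s : ℂ) * g s‖ ≤ x ^ (ν / 2) * (w s * ‖g s‖) := by
    intro s hs
    rw [norm_mul, Complex.norm_of_nonneg (solKer_nonneg hx0.le (le_of_lt hs)), ← mul_assoc, hw,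
      indicator_of_mem hs]
    gcongr
    exact solKer_le hα hν hνβ hx0 hs
  calc ‖solL hb α β g x‖ = ‖∫ s in Ioi x, solKer α β x s * g s ∂(μ b)‖ := by rw [hsol]
    _ ≤ ∫ s in Ioi x, x ^ (ν / 2) * (w s * ‖g s‖) ∂(μ b) :=
        norm_integral_le_of_norm_le hwg.restrict (ae_restrict_of_forall_mem measurableSet_Ioi hker)
    _ ≤ ∫ s, x ^ (ν / 2) * (w s * ‖g s‖) ∂(μ b) :=
        setIntegral_le_integral hwg (.of_forall fun s =>
          mul_nonneg (Real.rpow_nonneg hx0.le _) (mul_nonneg (hw0 s) (norm_nonneg _)))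
    _ ≤ x ^ (ν / 2) * (solConst ν * ‖g‖) := by
        rw [integral_const_mul]
        gcongr
        refine (integral_mul_norm_le hw2 (.of_forall hw0) g).trans ?_
        rw [solConst]
        gcongr
        exact (integral_indicator_rpow_sub_sq_le hr hx).trans_eq (by ring_nf)

end SolutionBound

section KernelBound

variable {α β ν s x y z : ℝ}

theorem mul_sub_le_rpow_sub_rpow (hs : 0 ≤ s) (hx : 0 < x) (hy : 0 ≤ y) :
    (s + 1) * x ^ s * (y - x) ≤ y ^ (s + 1) - x ^ (s + 1) := by
  have hyx : 0 ≤ y / x := div_nonneg hy hx.le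
  have h := one_add_mul_self_le_rpow_one_add (s := y / x - 1) (p := s + 1) (by linarith)
    (by linarith)
  rw [add_sub_cancel, Real.div_rpow hy hx.le, le_div_iff₀ (Real.rpow_pos_of_pos hx _)] at h
  have hxs : x ^ (s + 1) = x ^ s * x := Real.rpow_add_one hx.ne' s
  calc (s + 1) * x ^ s * (y - x) = (1 + (s + 1) * (y / x - 1)) * x ^ (s + 1) - x ^ (s + 1) := by
        rw [hxs]
        field_simp
        ring
    _ ≤ y ^ (s + 1) - x ^ (s + 1) := by gcongr

theorem abs_rpow_sub_rpow_le {M : ℝ} (hs : 0 ≤ s) (hx : x ∈ Ioc 0 M) (hy : y ∈ Ioc 0 M) :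
    |x ^ (s + 1) - y ^ (s + 1)| ≤ (s + 1) * M ^ s * |x - y| := by
  wlog hxy : x ≤ y generalizing x y
  · rw [abs_sub_comm, abs_sub_comm x]
    exact this hy hx (le_of_not_ge hxy)
  have hpow : x ^ (s + 1) ≤ y ^ (s + 1) := Real.rpow_le_rpow hx.1.le hxy (by linarith)
  rw [abs_of_nonpos (sub_nonpos.2 hpow), abs_of_nonpos (sub_nonpos.2 hxy), neg_sub, neg_sub]
  calc y ^ (s + 1) - x ^ (s + 1) ≤ (s + 1) * y ^ s * (y - x) := by
        linarith [mul_sub_le_rpow_sub_rpow hs hy.1 hx.1.le]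
    _ ≤ (s + 1) * M ^ s * (y - x) :=
        mul_le_mul_of_nonneg_right (mul_le_mul_of_nonneg_left
          (Real.rpow_le_rpow hy.1.le hy.2 hs) (by linarith)) (sub_nonneg.2 hxy)

theorem norm_add_mul_ofReal_le {X Y Z M : ℝ} (hYZ : Y < Z) (hY : |X - Y| ≤ M * (Z - Y))
    (hZ : |X - Z| ≤ M * (Z - Y)) (c₀ c₁ : ℂ) :
    ‖c₀ + c₁ * X‖ ≤ M * (‖c₀ + c₁ * Y‖ + ‖c₀ + c₁ * Z‖) := by
  have hZY : 0 < Z - Y := sub_pos.2 hYZ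
  refine le_of_mul_le_mul_left ?_ hZY
  calc (Z - Y) * ‖c₀ + c₁ * X‖ = ‖((Z - Y : ℝ) : ℂ) * (c₀ + c₁ * X)‖ := by
        rw [norm_mul, Complex.norm_of_nonneg hZY.le]
    _ = ‖((X - Y : ℝ) : ℂ) * (c₀ + c₁ * Z) - ((X - Z : ℝ) : ℂ) * (c₀ + c₁ * Y)‖ := by
        push_cast
        ring_nf
    _ ≤ |X - Y| * ‖c₀ + c₁ * Z‖ + |X - Z| * ‖c₀ + c₁ * Y‖ := by
        refine (norm_sub_le _ _).trans_eq ?_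
        rw [norm_mul, norm_mul, Complex.norm_real, Complex.norm_real, Real.norm_eq_abs,
          Real.norm_eq_abs]
    _ ≤ M * (Z - Y) * ‖c₀ + c₁ * Z‖ + M * (Z - Y) * ‖c₀ + c₁ * Y‖ := by gcongr
    _ = (Z - Y) * (M * (‖c₀ + c₁ * Y‖ + ‖c₀ + c₁ * Z‖)) := by ring

theorem abs_rpow_sub_rpow_le_mul_rpow_sub_rpow (hb : 0 < b) (hα : 0 ≤ α)
    (hx : x ∈ Ioo b (b + 1)) (hy : y ∈ Ioo (b + 1 / 2) (b + 5 / 8))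
    (hz : z ∈ Ioo (b + 7 / 8) (b + 1)) {w : ℝ} (hw : w ∈ Ioo b (b + 1)) :
    |x ^ (α + 1) - w ^ (α + 1)| ≤ 4 * 2 ^ α * (z ^ (α + 1) - y ^ (α + 1)) := by
  obtain ⟨hx1, hx2⟩ := hx
  obtain ⟨hy1, hy2⟩ := hy
  obtain ⟨hz1, hz2⟩ := hz
  obtain ⟨hw1, hw2⟩ := hw
  have hxw : |x - w| ≤ 1 := abs_le.2 ⟨by linarith, by linarith⟩
  have hzy : 1 / 4 ≤ z - y := by linarith
  have hy0 : 0 < y := by linarith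
  calc |x ^ (α + 1) - w ^ (α + 1)| ≤ (α + 1) * (b + 1) ^ α * |x - w| :=
        abs_rpow_sub_rpow_le hα ⟨hb.trans hx1, hx2.le⟩ ⟨hb.trans hw1, hw2.le⟩
    _ ≤ (α + 1) * (2 * y) ^ α * 1 := by
        gcongr
        linarith
    _ = 4 * 2 ^ α * ((α + 1) * y ^ α * (1 / 4)) := by
        rw [Real.mul_rpow zero_le_two hy0.le]
        ring
    _ ≤ 4 * 2 ^ α * ((α + 1) * y ^ α * (z - y)) := by gcongr
    _ ≤ 4 * 2 ^ α * (z ^ (α + 1) - y ^ (α + 1)) := by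
        gcongr
        exact mul_sub_le_rpow_sub_rpow hα hy0 (by linarith)

/-- The representative `x ^ β (c₀ + c₁ x ^ (α + 1))` of `kerL c`. -/
def kerFun (α β : ℝ) (c : EuclideanSpace ℂ (Fin 2)) (x : ℝ) : ℂ :=
  ((x ^ β : ℝ) : ℂ) * (c 0 + c 1 * ((x ^ (α + 1) : ℝ) : ℂ))

theorem coeFn_kerL (hb : 0 < b) (α β : ℝ) (c : EuclideanSpace ℂ (Fin 2)) :
    kerL hb α β c =ᵐ[μ b] kerFun α β c := by
  rw [kerL_apply]
  filter_upwards [Lp.coeFn_add (c 0 • powOp hb β (one b)) (c 1 • powOp hb (α + β + 1) (one b)),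
    Lp.coeFn_smul (c 0) (powOp hb β (one b)), Lp.coeFn_smul (c 1) (powOp hb (α + β + 1) (one b)),
    coeFn_powOp hb β (one b), coeFn_powOp hb (α + β + 1) (one b), coeFn_one (b := b),
    ae_restrict_mem measurableSet_Ioo] with x h1 h2 h3 h4 h5 h6 hx
  rw [h1, Pi.add_apply, h2, h3, Pi.smul_apply, Pi.smul_apply, h4, h5, h6, kerFun,
    show α + β + 1 = β + (α + 1) by ring, Real.rpow_add (hb.trans hx.1), smul_eq_mul, smul_eq_mul]
  push_cast
  ring

theorem norm_kerFun (hx : 0 ≤ x) (c : EuclideanSpace ℂ (Fin 2)) :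
    ‖kerFun α β c x‖ = x ^ β * ‖c 0 + c 1 * ((x ^ (α + 1) : ℝ) : ℂ)‖ := by
  rw [kerFun, norm_mul, Complex.norm_of_nonneg (Real.rpow_nonneg hx _)]

theorem rpow_mul_norm_le_norm_kerFun (hb : 0 < b) (hν : 0 ≤ ν) (hνβ : ν ≤ 2 * β) (hx : 0 ≤ x)
    (hxb : x ≤ b + 1) (hy : b + 1 / 2 ≤ y) (c : EuclideanSpace ℂ (Fin 2)) :
    x ^ (β - ν / 2) * ‖c 0 + c 1 * ((y ^ (α + 1) : ℝ) : ℂ)‖ ≤ 2 ^ β * ‖kerFun α β c y‖ := by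
  have hy0 : 0 ≤ y := by linarith
  rw [norm_kerFun hy0, ← mul_assoc, ← Real.mul_rpow zero_le_two hy0]
  gcongr
  calc x ^ (β - ν / 2) ≤ (2 * y) ^ (β - ν / 2) := Real.rpow_le_rpow hx (by linarith) (by linarith)
    _ ≤ (2 * y) ^ β := Real.rpow_le_rpow_of_exponent_le (by linarith) (by linarith)

theorem norm_kerFun_le_mul_add (hb : 0 < b) (hα : 0 ≤ α) (hν : 0 ≤ ν) (hνβ : ν ≤ 2 * β)
    (hx : x ∈ Ioo b (b + 1)) (hy : y ∈ Ioo (b + 1 / 2) (b + 5 / 8))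
    (hz : z ∈ Ioo (b + 7 / 8) (b + 1)) (c : EuclideanSpace ℂ (Fin 2)) :
    ‖kerFun α β c x‖ ≤
      x ^ (ν / 2) * (4 * 2 ^ α * 2 ^ β * (‖kerFun α β c y‖ + ‖kerFun α β c z‖)) := by
  have hx0 : 0 < x := hb.trans hx.1
  have hab (w : ℝ) (hw : w ∈ Ioo b (b + 1)) :=
    abs_rpow_sub_rpow_le_mul_rpow_sub_rpow hb hα hx hy hz hw
  have hle (w : ℝ) (hw : b + 1 / 2 ≤ w) :=
    rpow_mul_norm_le_norm_kerFun (α := α) hb hν hνβ hx0.le hx.2.le hw c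
  have hyz : y ^ (α + 1) < z ^ (α + 1) :=
    Real.rpow_lt_rpow (by linarith [hy.1]) (by linarith [hy.2, hz.1]) (by linarith)
  have hlin := norm_add_mul_ofReal_le hyz
    (hab y ⟨by linarith [hy.1], by linarith [hy.2]⟩) (hab z ⟨by linarith [hz.1], hz.2⟩) (c 0) (c 1)
  rw [norm_kerFun hx0.le, ← add_sub_cancel (ν / 2) β, Real.rpow_add hx0, mul_assoc,
    add_sub_cancel]
  refine mul_le_mul_of_nonneg_left ?_ (Real.rpow_nonneg hx0.le _)
  calc x ^ (β - ν / 2) * ‖c 0 + c 1 * ((x ^ (α + 1) : ℝ) : ℂ)‖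
      ≤ x ^ (β - ν / 2) * (4 * 2 ^ α * (‖c 0 + c 1 * ((y ^ (α + 1) : ℝ) : ℂ)‖ +
          ‖c 0 + c 1 * ((z ^ (α + 1) : ℝ) : ℂ)‖)) := by gcongr
    _ = 4 * 2 ^ α * (x ^ (β - ν / 2) * ‖c 0 + c 1 * ((y ^ (α + 1) : ℝ) : ℂ)‖ +
          x ^ (β - ν / 2) * ‖c 0 + c 1 * ((z ^ (α + 1) : ℝ) : ℂ)‖) := by ring
    _ ≤ 4 * 2 ^ α * (2 ^ β * ‖kerFun α β c y‖ + 2 ^ β * ‖kerFun α β c z‖) :=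
        mul_le_mul_of_nonneg_left (add_le_add (hle y hy.1.le) (hle z (by linarith [hz.1])))
          (by positivity)
    _ = 4 * 2 ^ α * 2 ^ β * (‖kerFun α β c y‖ + ‖kerFun α β c z‖) := by ring

theorem exists_norm_le_of_ae_eq {u : L2 b} {f : ℝ → ℂ} (hf : u =ᵐ[μ b] f) {l r : ℝ} (hl : b ≤ l)
    (hlr : l < r) (hr : r ≤ b + 1) : ∃ y ∈ Ioo l r, ‖f y‖ ≤ √(r - l)⁻¹ * ‖u‖ := by
  have hsub : Ioo l r ⊆ Ioo b (b + 1) := Ioo_subset_Ioo hl hr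
  have hf2 : (fun x => ‖u x‖ ^ 2) =ᵐ[μ b] fun x => ‖f x‖ ^ 2 := hf.fun_comp fun z => ‖z‖ ^ 2
  have hi : IntegrableOn (fun x => ‖f x‖ ^ 2) (Ioo b (b + 1)) :=
    ((Lp.memLp u).integrable_norm_pow two_ne_zero).congr hf2
  have hfu : ∫ x in Ioo b (b + 1), ‖f x‖ ^ 2 = ‖u‖ ^ 2 := by
    rw [norm_sq_eq_integral]
    exact integral_congr_ae hf2.symm
  obtain ⟨y, hy, hle⟩ := exists_le_setAverage (s := Ioo l r) (μ := volume)
    (by simpa using hlr) (by simp) (hi.mono_set hsub)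
  refine ⟨y, hy, ?_⟩
  rw [← Real.sqrt_sq (norm_nonneg u), ← Real.sqrt_mul (by simpa using hlr.le)]
  refine Real.le_sqrt_of_sq_le (hle.trans ?_)
  rw [setAverage_eq, Real.volume_real_Ioo_of_le hlr.le, smul_eq_mul, ← hfu]
  gcongr
  exact .of_forall fun _ => sq_nonneg _

/-- The constant in the pointwise bound `norm_kerL_le`. -/
def kerConst (α β : ℝ) : ℝ := 4 * 2 ^ α * 2 ^ β * (2 * √8)

/-- Each quarter of `(b + 1/2, b + 1)` at either end contains a point at which `|kerL c|` is at most
`√8 ‖kerL c‖`, and two such points control an affine function of `x ^ (α + 1)`. -/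
theorem norm_kerL_le (hb : 0 < b) (hα : 0 ≤ α) (hν : 0 ≤ ν) (hνβ : ν ≤ 2 * β)
    (c : EuclideanSpace ℂ (Fin 2)) :
    ∀ᵐ x ∂(μ b), ‖kerL hb α β c x‖ ≤ x ^ (ν / 2) * (kerConst α β * ‖kerL hb α β c‖) := by
  have hker := coeFn_kerL hb α β c
  obtain ⟨y, hy, hy'⟩ := exists_norm_le_of_ae_eq hker (l := b + 1 / 2) (r := b + 5 / 8)
    (by linarith) (by linarith) (by linarith)
  obtain ⟨z, hz, hz'⟩ := exists_norm_le_of_ae_eq hker (l := b + 7 / 8) (r := b + 1)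
    (by linarith) (by linarith) le_rfl
  rw [show (b + 5 / 8 - (b + 1 / 2))⁻¹ = 8 by ring] at hy'
  rw [show (b + 1 - (b + 7 / 8))⁻¹ = 8 by ring] at hz'
  filter_upwards [hker, ae_restrict_mem measurableSet_Ioo] with x hkx hx
  have hx0 : 0 < x := hb.trans hx.1
  calc ‖kerL hb α β c x‖ = ‖kerFun α β c x‖ := by rw [hkx]
    _ ≤ x ^ (ν / 2) * (4 * 2 ^ α * 2 ^ β * (‖kerFun α β c y‖ + ‖kerFun α β c z‖)) :=
        norm_kerFun_le_mul_add hb hα hν hνβ hx hy hz c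
    _ ≤ x ^ (ν / 2) * (4 * 2 ^ α * 2 ^ β * (√8 * ‖kerL hb α β c‖ + √8 * ‖kerL hb α β c‖)) := by
        gcongr
    _ = x ^ (ν / 2) * (kerConst α β * ‖kerL hb α β c‖) := by
        rw [kerConst]
        ring

end KernelBound

section SupBound

variable {α β ν : ℝ}

theorem norm_solL_le_mul_norm (hb : 0 < b) (hα : 0 ≤ α) (hβ : 0 ≤ β) (g : L2 b) :
    ‖solL hb α β g‖ ≤ solConst 0 * ‖g‖ := by
  refine norm_le_of_ae_norm_le (mul_nonneg (Real.sqrt_nonneg _) (norm_nonneg g)) ?_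
  have hβ' : 0 ≤ 2 * β := mul_nonneg zero_le_two hβ
  filter_upwards [norm_solL_le hb hα le_rfl three_pos hβ' g] with x hx
  rwa [zero_div, Real.rpow_zero, one_mul] at hx

/-- The constant in the pointwise bound `norm_paramL_le`. -/
def supConst (α β ν : ℝ) : ℝ := kerConst α β * (1 + solConst 0) + solConst ν

theorem kerConst_pos (α β : ℝ) : 0 < kerConst α β := by
  unfold kerConst
  positivity

theorem solConst_le_supConst (α β ν : ℝ) : solConst ν ≤ supConst α β ν :=
  le_add_of_nonneg_left (mul_nonneg (kerConst_pos α β).le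
    (add_nonneg zero_le_one (Real.sqrt_nonneg _)))

theorem supConst_pos (α β ν : ℝ) : 0 < supConst α β ν :=
  add_pos_of_pos_of_nonneg (mul_pos (kerConst_pos α β)
    (add_pos_of_pos_of_nonneg one_pos (Real.sqrt_nonneg _))) (Real.sqrt_nonneg _)

theorem norm_paramL_le (hb : 0 < b) (hα : 0 ≤ α) (hν : 0 ≤ ν) (hν3 : ν < 3) (hνβ : ν ≤ 2 * β)
    (k : Param b) : ∀ᵐ x ∂(μ b), ‖paramL hb α β k x‖ ≤
      x ^ (ν / 2) * (supConst α β ν * (‖k.snd‖ + ‖paramL hb α β k‖)) := by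
  have hker : ‖kerL hb α β k.fst‖ ≤ solConst 0 * ‖k.snd‖ + ‖paramL hb α β k‖ := by
    rw [← add_sub_cancel_right (kerL hb α β k.fst) (solL hb α β k.snd), ← paramL_apply, add_comm]
    exact (norm_sub_le _ _).trans (by gcongr; exact norm_solL_le_mul_norm hb hα (by linarith) _)
  have hk := (kerConst_pos α β).le
  have hs (r : ℝ) : 0 ≤ solConst r := Real.sqrt_nonneg _
  filter_upwards [norm_kerL_le hb hα hν hνβ k.fst, norm_solL_le hb hα hν hν3 hνβ k.snd,
    Lp.coeFn_add (kerL hb α β k.fst) (solL hb α β k.snd), ae_restrict_mem measurableSet_Ioo]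
    with x hkx hsx hadd hx
  have hxν : 0 ≤ x ^ (ν / 2) := Real.rpow_nonneg (hb.trans hx.1).le _
  calc ‖paramL hb α β k x‖ ≤ ‖kerL hb α β k.fst x‖ + ‖solL hb α β k.snd x‖ := by
        rw [paramL_apply, hadd]
        exact norm_add_le _ _
    _ ≤ x ^ (ν / 2) * (kerConst α β * (solConst 0 * ‖k.snd‖ + ‖paramL hb α β k‖)) +
          x ^ (ν / 2) * (solConst ν * ‖k.snd‖) := by
        refine add_le_add (hkx.trans ?_) hsx
        gcongr
    _ ≤ x ^ (ν / 2) * (kerConst α β * ((1 + solConst 0) * (‖k.snd‖ + ‖paramL hb α β k‖))) +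
          x ^ (ν / 2) * (solConst ν * (‖k.snd‖ + ‖paramL hb α β k‖)) := by
        have := mul_nonneg (hs 0) (norm_nonneg (paramL hb α β k))
        gcongr
        · linarith [norm_nonneg k.snd]
        · exact hs ν
        · linarith [norm_nonneg (paramL hb α β k)]
    _ = x ^ (ν / 2) * (supConst α β ν * (‖k.snd‖ + ‖paramL hb α β k‖)) := by
        rw [supConst]
        ring

end SupBound

section PotentialForm

variable {V : ℝ → ℝ} (hV : MemLp V ∞ (μ b))

theorem inner_mulOp_ae_eq (u : L2 b) :
    (fun x => inner ℂ (u x) (mulOp V hV u x)) =ᵐ[μ b] fun x => ((V x * ‖u x‖ ^ 2 : ℝ) : ℂ) := by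
  filter_upwards [coeFn_mulOp V hV u] with x hx
  rw [hx, RCLike.inner_apply, mul_assoc, Complex.mul_conj']
  push_cast
  rfl

theorem re_inner_mulOp (u : L2 b) :
    (inner ℂ u (mulOp V hV u)).re = ∫ x, V x * ‖u x‖ ^ 2 ∂(μ b) := by
  rw [L2.inner_def, integral_congr_ae (inner_mulOp_ae_eq hV u), integral_complex_ofReal,
    Complex.ofReal_re]

include hV in
theorem integrable_mul_norm_sq (u : L2 b) : Integrable (fun x => V x * ‖u x‖ ^ 2) (μ b) :=
  ((L2.integrable_inner (𝕜 := ℂ) u (mulOp V hV u)).congr (inner_mulOp_ae_eq hV u)).re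

theorem re_inner_mulOp_le (hb : 0 < b) {ν D M : ℝ} (hV0 : ∀ᵐ x ∂(μ b), 0 ≤ V x)
    (hD : ∫ x in Ioo b (b + 1), V x * x ^ ν ≤ D) {u : L2 b}
    (hu : ∀ᵐ x ∂(μ b), ‖u x‖ ≤ x ^ (ν / 2) * M) :
    (inner ℂ u (mulOp V hV u)).re ≤ D * M ^ 2 := by
  have hi : Integrable (fun x => V x * x ^ ν) (μ b) :=
    (MemLp.mul (r := ∞) (memLp_rpow hb ν) hV).integrable le_top
  calc (inner ℂ u (mulOp V hV u)).re = ∫ x, V x * ‖u x‖ ^ 2 ∂(μ b) := re_inner_mulOp hV u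
    _ ≤ ∫ x, V x * x ^ ν * M ^ 2 ∂(μ b) := by
        refine integral_mono_ae (integrable_mul_norm_sq hV u) (hi.mul_const _) ?_
        filter_upwards [hV0, hu, ae_restrict_mem measurableSet_Ioo] with x hVx hux hx
        have hsq : (x ^ (ν / 2)) ^ 2 = x ^ ν := by
          rw [← Real.rpow_mul_natCast (hb.trans hx.1).le, Nat.cast_ofNat,
            div_mul_cancel₀ ν two_ne_zero]
        rw [mul_assoc, ← hsq, ← mul_pow]
        gcongr
    _ = (∫ x in Ioo b (b + 1), V x * x ^ ν) * M ^ 2 := integral_mul_const _ _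
    _ ≤ D * M ^ 2 := by gcongr

theorem re_inner_mulOp_le_of_norm_le_supConst (hb : 0 < b) {α β ν M : ℝ}
    (hV0 : ∀ᵐ x ∂(μ b), 0 ≤ V x)
    (hD : ∫ x in Ioo b (b + 1), V x * x ^ ν ≤ (4 * supConst α β ν ^ 2)⁻¹) {u : L2 b}
    (hu : ∀ᵐ x ∂(μ b), ‖u x‖ ≤ x ^ (ν / 2) * (supConst α β ν * M)) :
    (inner ℂ u (mulOp V hV u)).re ≤ M ^ 2 / 4 := by
  have hC := (supConst_pos α β ν).ne'
  exact (re_inner_mulOp_le hV hb hV0 hD hu).trans_eq (by field_simp)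

theorem re_inner_mulOp_pos (hV0 : ∀ᵐ x ∂(μ b), 0 ≤ V x) (hVne : ¬ ∀ᵐ x ∂(μ b), V x = 0) {u : L2 b}
    (hu : ∀ᵐ x ∂(μ b), u x ≠ 0) : 0 < (inner ℂ u (mulOp V hV u)).re := by
  have hnn : 0 ≤ᵐ[μ b] fun x => V x * ‖u x‖ ^ 2 :=
    hV0.mono fun x hx => mul_nonneg hx (sq_nonneg _)
  rw [re_inner_mulOp]
  refine (integral_nonneg_of_ae hnn).lt_of_ne fun h => hVne ?_
  filter_upwards [(integral_eq_zero_iff_of_nonneg_ae hnn (integrable_mul_norm_sq hV u)).1 h.symm,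
    hu] with x hx hux
  exact (mul_eq_zero.1 hx).resolve_right (pow_ne_zero 2 (norm_ne_zero_iff.2 hux))

end PotentialForm

section KernelZeros

variable {α : ℝ}

theorem subsingleton_zeros_kerFun (hα : 0 ≤ α) (β : ℝ) {c : EuclideanSpace ℂ (Fin 2)}
    (hc : c ≠ 0) : {x : ℝ | 0 < x ∧ kerFun α β c x = 0}.Subsingleton := by
  have hlin {x : ℝ} (hx : 0 < x) (h : kerFun α β c x = 0) :
      c 0 + c 1 * ((x ^ (α + 1) : ℝ) : ℂ) = 0 :=
    (mul_eq_zero.1 h).resolve_left (Complex.ofReal_ne_zero.2 (Real.rpow_pos_of_pos hx β).ne')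
  rintro x ⟨hx, hx0⟩ y ⟨hy, hy0⟩
  have hc₁ : c 1 ≠ 0 := fun h => hc <| by
    have h0 := hlin hx hx0
    rw [h, zero_mul, add_zero] at h0
    ext i
    fin_cases i
    exacts [h0, h]
  have hxy : c 1 * ((x ^ (α + 1) : ℝ) : ℂ) = c 1 * ((y ^ (α + 1) : ℝ) : ℂ) :=
    add_left_cancel ((hlin hx hx0).trans (hlin hy hy0).symm)
  exact (Real.rpow_left_inj hx.le hy.le (by linarith)).1
    (Complex.ofReal_injective (mul_left_cancel₀ hc₁ hxy))

theorem kerL_ae_ne_zero (hb : 0 < b) (hα : 0 ≤ α) (β : ℝ) {c : EuclideanSpace ℂ (Fin 2)}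
    (hc : c ≠ 0) : ∀ᵐ x ∂(μ b), kerL hb α β c x ≠ 0 := by
  have hnull : ∀ᵐ x ∂(μ b), ¬ (0 < x ∧ kerFun α β c x = 0) :=
    ae_restrict_of_ae (measure_eq_zero_iff_ae_notMem.1
      ((subsingleton_zeros_kerFun hα β hc).measure_zero volume))
  filter_upwards [coeFn_kerL hb α β c, hnull, ae_restrict_mem measurableSet_Ioo] with x hkx h hx
  exact fun h0 => h ⟨hb.trans hx.1, hkx ▸ h0⟩

theorem kerL_injective (hb : 0 < b) (hα : 0 ≤ α) (β : ℝ) : Function.Injective (kerL hb α β) := by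
  refine (injective_iff_map_eq_zero _).2 fun c h => by_contra fun hc => ?_
  have hne := kerL_ae_ne_zero hb hα β hc
  rw [h] at hne
  obtain ⟨x, hx, hx0⟩ := (hne.and (Lp.coeFn_zero ℂ 2 (μ b))).exists
  exact hx hx0

theorem paramL_injective (hb : 0 < b) (hα : 0 ≤ α) (β : ℝ) :
    Function.Injective (paramL hb α β) := by
  refine (injective_iff_map_eq_zero _).2 fun k hk => ?_
  have hsnd : k.snd = 0 := by
    have h0 : paramH2 hb α β k = 0 := Subtype.ext hk
    rw [← powOp_powOp_neg hb (α + β) k.snd, ← secondOp_paramH2, h0, map_zero, map_zero]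
  rw [paramL_apply, hsnd, map_zero, add_zero] at hk
  have hfst : k.fst = 0 := kerL_injective hb hα β (hk.trans (map_zero _).symm)
  exact (WithLp.ofLp_injective 2) (Prod.ext hfst hsnd)

end KernelZeros

section Spectrum

/-- The inclusion `c ↦ (c, 0)` of the parameter space of `kerL` into that of `paramL`. -/
def kerIncl (b : ℝ) : EuclideanSpace ℂ (Fin 2) →ₗ[ℂ] Param b :=
  (WithLp.linearEquiv 2 ℂ _).symm.toLinearMap ∘ₗ LinearMap.inl ℂ _ _

theorem kerIncl_injective : Function.Injective (kerIncl b) := fun _ _ h => congrArg WithLp.fst h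

/-- The parameters `(c, 0)`, which `paramL` maps onto the functions annihilated by the form
`h_b`. -/
abbrev kerParam (b : ℝ) : Submodule ℂ (Param b) := (kerIncl b).range

theorem finrank_kerParam : Module.finrank ℂ (kerParam b) = 2 :=
  (LinearMap.finrank_range_of_inj kerIncl_injective).trans finrank_euclideanSpace_fin

theorem snd_eq_zero_of_mem_kerParam {k : Param b} (hk : k ∈ kerParam b) : k.snd = 0 := by
  obtain ⟨c, rfl⟩ := hk
  rfl

theorem fst_eq_zero_of_mem_orthogonal {k : Param b} (hk : k ∈ (kerParam b)ᗮ) : k.fst = 0 := by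
  have h := hk (kerIncl b k.fst) ⟨k.fst, rfl⟩
  simpa [kerIncl, WithLp.prod_inner_apply] using h

variable {α β ν : ℝ} (hb : 0 < b) {V : ℝ → ℝ} (hV : MemLp V ∞ (μ b))

theorem reApplyInnerSelf_formOp_neg (hα : 0 ≤ α) (hV0 : ∀ᵐ x ∂(μ b), 0 ≤ V x)
    (hVne : ¬ ∀ᵐ x ∂(μ b), V x = 0) {k : Param b} (hk : k ∈ kerParam b) (hk0 : k ≠ 0) :
    (formOp hb α β V hV).reApplyInnerSelf k < 0 := by
  have hsnd := snd_eq_zero_of_mem_kerParam hk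
  have hfst : k.fst ≠ 0 := fun h => hk0 ((WithLp.ofLp_injective 2) (Prod.ext h hsnd))
  have hpos := re_inner_mulOp_pos hV hV0 hVne (kerL_ae_ne_zero hb hα β hfst)
  rw [reApplyInnerSelf_formOp, paramL_apply, hsnd]
  simpa using hpos

theorem half_mul_norm_sq_le_reApplyInnerSelf_formOp (hα : 0 ≤ α) (hν : 0 ≤ ν) (hν3 : ν < 3)
    (hνβ : ν ≤ 2 * β) (hV0 : ∀ᵐ x ∂(μ b), 0 ≤ V x)
    (hD : ∫ x in Ioo b (b + 1), V x * x ^ ν ≤ (4 * supConst α β ν ^ 2)⁻¹) {k : Param b}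
    (hk : k ∈ (kerParam b)ᗮ) :
    1 / 2 * ‖k‖ ^ 2 ≤ (formOp hb α β V hV).reApplyInnerSelf k := by
  have hfst := fst_eq_zero_of_mem_orthogonal hk
  have hnorm : ‖k‖ ^ 2 = ‖k.snd‖ ^ 2 := by simp [WithLp.prod_norm_sq_eq_of_L2, hfst]
  have hsol : paramL hb α β k = solL hb α β k.snd := by
    rw [paramL_apply, hfst, map_zero, zero_add]
  have hsup : ∀ᵐ x ∂(μ b), ‖paramL hb α β k x‖ ≤ x ^ (ν / 2) * (supConst α β ν * ‖k.snd‖) := by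
    filter_upwards [norm_solL_le hb hα hν hν3 hνβ k.snd, ae_restrict_mem measurableSet_Ioo]
      with x hsx hx
    rw [hsol]
    have hx0 := hb.trans hx.1
    refine hsx.trans ?_
    gcongr
    exact solConst_le_supConst α β ν
  have hle := re_inner_mulOp_le_of_norm_le_supConst hV hb hV0 hD hsup
  rw [reApplyInnerSelf_formOp, hnorm]
  linarith [sq_nonneg ‖k.snd‖]

theorem neg_half_mul_norm_sq_le_reApplyInnerSelf_formOp (hα : 0 ≤ α) (hν : 0 ≤ ν) (hν3 : ν < 3)
    (hνβ : ν ≤ 2 * β) (hV0 : ∀ᵐ x ∂(μ b), 0 ≤ V x)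
    (hD : ∫ x in Ioo b (b + 1), V x * x ^ ν ≤ (4 * supConst α β ν ^ 2)⁻¹) (k : Param b) :
    -(1 / 2) * ‖paramL hb α β k‖ ^ 2 ≤ (formOp hb α β V hV).reApplyInnerSelf k := by
  have hle := re_inner_mulOp_le_of_norm_le_supConst hV hb hV0 hD
    (norm_paramL_le hb hα hν hν3 hνβ k)
  rw [reApplyInnerSelf_formOp]
  linarith [add_sq_le (a := ‖k.snd‖) (b := ‖paramL hb α β k‖), sq_nonneg ‖k.snd‖]

end Spectrum

end IntervalOp

end

open IntervalOp in
theorem proposition3_general (α β ν : ℝ) (hα : 0 ≤ α) (hν : 0 ≤ ν) (hν3 : ν < 3)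
    (hνβ : ν ≤ 2 * β) :
    ∃ D E : ℝ, 0 < D ∧ 0 < E ∧
      ∀ (b : ℝ) (hb : 0 < b) (V : ℝ → ℝ) (hV : MemLp V ∞ (μ b)),
        (∀ᵐ x ∂(μ b), 0 ≤ V x) →
        (¬ ∀ᵐ x ∂(μ b), V x = 0) →
        ∫ x in Ioo b (b + 1), V x * x ^ ν ≤ D →
        ∃ E₁ E₂ : ℝ, 0 < E₁ ∧ 0 < E₂ ∧ E₁ ≤ E ∧ E₂ ≤ E ∧
          negSpectrum (HbSub hb α β V hV) = {-E₁, -E₂} ∧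
          ∀ t : ℝ, t < 0 →
            Module.rank ℂ (eigenspace (HbSub hb α β V hV) (t : ℂ)) =
              (if t = -E₁ then 1 else 0) + (if t = -E₂ then 1 else 0) := by
  refine ⟨(4 * supConst α β ν ^ 2)⁻¹, 1 / 2, ?_, one_half_pos, ?_⟩
  · have := supConst_pos α β ν
    positivity
  intro b hb V hV hV0 hVne hD
  have hspectrum := (isRepresentedBy_formOp hb β V hV hα).exists_negSpectrum_eq_range
    (isSelfAdjoint_formOp hb α β V hV) (paramL_injective hb hα β) one_half_pos
    (fun _ => half_mul_norm_sq_le_reApplyInnerSelf_formOp hb hV hα hν hν3 hνβ hV0 hD)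
    (fun _ => reApplyInnerSelf_formOp_neg hb hV hα hV0 hVne)
    (neg_half_mul_norm_sq_le_reApplyInnerSelf_formOp hb hV hα hν hν3 hνβ hV0 hD)
  rw [finrank_kerParam] at hspectrum
  obtain ⟨t, ht, hspec, hrank⟩ := hspectrum
  refine ⟨-t 0, -t 1, neg_pos.2 (ht 0).1, neg_pos.2 (ht 1).1, neg_le.1 (ht 0).2, neg_le.1 (ht 1).2,
    ?_, fun s hs => ?_⟩
  · ext s
    simp only [hspec, neg_neg, mem_range, Fin.exists_fin_two, mem_insert_iff, mem_singleton_iff,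
      eq_comm]
  · rw [hrank s hs, Fintype.card_subtype, Finset.card_filter, Fin.sum_univ_two]
    simp only [neg_neg, eq_comm (a := s), Nat.cast_add, Nat.cast_ite, Nat.cast_one, Nat.cast_zero]

theorem proposition3 (α β ν : ℝ) (hα : 0 ≤ α) (hβ : 0 ≤ β) (hβα : β < 3 / 2 + α)
    (hν : 0 ≤ ν) (hν3 : ν < 3) (hνβ : ν ≤ 2 * β) :
    ∃ D E : ℝ, 0 < D ∧ 0 < E ∧
      ∀ (b : ℝ) (hb : 0 < b) (V : ℝ → ℝ) (hV : MemLp V ∞ (IntervalOp.μ b)),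
        (∀ᵐ x ∂(IntervalOp.μ b), 0 ≤ V x) →
        (¬ ∀ᵐ x ∂(IntervalOp.μ b), V x = 0) →
        ∫ x in Ioo b (b + 1), V x * x ^ ν ≤ D →
        ∃ E₁ E₂ : ℝ, 0 < E₁ ∧ 0 < E₂ ∧ E₁ ≤ E ∧ E₂ ≤ E ∧
          IntervalOp.negSpectrum (IntervalOp.HbSub hb α β V hV) = {-E₁, -E₂} ∧
          -- counted with multiplicity: `t < 0` is an eigenvalue as often as it occurs
          -- among `-E₁` and `-E₂`
          ∀ t : ℝ, t < 0 →
            Module.rank ℂ (IntervalOp.eigenspace (IntervalOp.HbSub hb α β V hV) (t : ℂ)) =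
              (if t = -E₁ then 1 else 0) + (if t = -E₂ then 1 else 0) :=
  proposition3_general α β ν hα hν hν3 hνβ
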